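/- Let $\mathcal{E}$ be a Grothendieck topos, $\gamma\colon\mathcal{E}\to\mathit{Sets}$ its structure morphism, so that $\gamma^*S=\coprod_{s\in S}1$. All families $H\to\gamma^*S$ are assumed to have non-empty (non-initial) components $H_s$, the fibre over $s\in S$. Let $\zeta_\bullet\colon H_\bullet\to\gamma^*S_\bullet$ be a simplicial family (a map of simplicial objects of $\mathcal{E}$, $S_\bullet$ a simplicial set), with $I=S_0$, $U=H_0$, such that $U\to 1$ is epimorphic (so $U\to\gamma^*I$ is a cover) and all maps $H_{n+1}\to(\mathrm{cosk}_n H_\bullet)_{n+1}$, $n\ge 0$, are epimorphic; that is, $H_\bullet$ is a hypercover refinement of the Čech simplicial family of the cover $U\to\gamma^*I$. Assume that it is self-dual: there are compatible isomorphisms $\tau_n$ of $H_n$ and of $S_n$ (written $w\mapsto w^{op}$ on $S_n$), equal to the identity for $n=0$, with $d_i\tau_n=\tau_{n-1}d_{n-i}$ and $s_i\tau_{n-1}=\tau_n s_{n-1-i}$. For $\ell\in S_1$ write $\ell\colon i\to j$ if $\partial_1\ell=i$, $\partial_0\ell=j$, and call $U_i\xleftarrow{d_1}(H_1)_\ell\xrightarrow{d_0}U_j$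 the span of $\ell$. Assume condition G: for every $\ell\colon i\to j$ there is $w\in S_2$ with $\partial_2w=\ell$, $\partial_0w=\ell^{op}$ such that the two legs $(d_1)_{\partial_1w},(d_0)_{\partial_1w}\colon(H_1)_{\partial_1w}\to U_i$ are equal. The \emph{G-fundamental groupoid} $\mathbf{G}$ has object set $I$; its arrows are the finite composable sequences of 1-simplices modulo the congruence generated by $\partial_1w\sim(\partial_0w\,\partial_2w)$ for $w\in S_2$, $\sigma_0(i)\sim\mathrm{id}_i$ for $i\in I$, and $\ell\sim t$ whenever $\ell,t\colon i\to j$ and there is a morphism from the span of $\ell$ to the span of $t$. An \emph{$S_\bullet$-descent datum} on a family of sets $R=(R_i)_{i\in I}$ consists of bijections $s_\ell\colon R_i\to R_j$ for $\ell\colon i\to j$ in $S_1$ with $s_{\sigma_0(i)}=\mathrm{id}$ and $s_{\partial_1w}=s_{\partial_0w}\circ s_{\partial_2w}$ for $w\in S_2$; it is \emph{consistent} if $s_\ell=s_t$ whenever there is a morphism from the span of $\ell$ to the span of $t$. A \emph{locally constant object} trivialized by $U$ is an object $X$ of $\mathcal{E}$ with a family of sets $R$ and isomorphisms $\theta_i\colon\gamma^*R_i\times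 U_i\to X\times U_i$ over $U_i$ $(i\in I)$; a morphism is a pair of a map $X\to X'$ and a family of functions $R_i\to R'_i$ compatible with $\theta$, $\theta'$. Its descent datum is the family of isomorphisms $\sigma_{j,i}\colon\gamma^*R_i\times U_i\times U_j\to\gamma^*R_j\times U_j\times U_i$ over the symmetry $U_i\times U_j\cong U_j\times U_i$ such that $(\theta_j\times U_i)\circ\sigma_{j,i}=(X\times\mathrm{symm})\circ(\theta_i\times U_j)$; it satisfies, in terms of generalized elements and with $\sigma_{j,i}$ also denoting its first component, $\sigma_{i,i}(a,x,x)=a$ and $\sigma_{k,j}(\sigma_{j,i}(a,x,y),y,z)=\sigma_{k,i}(a,x,z)$. In general a \emph{descent datum} $(R,\sigma)$ is a family of sets $R$ with isomorphisms $\sigma_{j,i}$ over the symmetries that satisfy these two conditions. A morphism $(R,\sigma)\to(R',\sigma')$ of descent data is a family of functions $R_i\to R'_i$ compatible with $\sigma,\sigma'$. An \emph{action span} is a span $U_i\xleftarrow{u}V\xrightarrow{v}U_j$, $V$ non-empty, for which there is a bijection $s\colon R_i\to R_j$ with $\sigma_{j,i}\circ(\gamma^*R_i\times(u,v))=(\gamma^*R_j\times(v,u))\circ(\gamma^*s\times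 V)$. A locally constant object, or a descent datum, is a \emph{covering projection} if for all $i,j$ with $U_i\times U_j$ non-empty the maps $(u,v)\colon V\to U_i\times U_j$, for all action spans, form an epimorphic family. It is \emph{trivialized by} an $S_\bullet$-descent datum $(s_\ell)$ on $R$ if, for all $\ell\colon i\to j$ in $S_1$, the isomorphism $\sigma_\ell:=\gamma^*s_\ell\times(\tau_1)_\ell\colon\gamma^*R_i\times(H_1)_\ell\to\gamma^*R_j\times(H_1)_{\ell^{op}}$ corresponds to $\sigma$, i.e. $\sigma_{j,i}\circ(\gamma^*R_i\times h_\ell)=(\gamma^*R_j\times h_{\ell^{op}})\circ\sigma_\ell$, where $h_\ell=((d_1)_\ell,(d_0)_\ell)\colon (H_1)_\ell\to U_i\times U_j$. \textbf{Theorem.} $\mathbf{G}$ is a groupoid, and the category of left actions of $\mathbf{G}$, i.e. of functors $\mathbf{G}\to\mathit{Sets}$ (the classifying topos of $\mathbf{G}$), is a Grothendieck topos. Sending $(X,R,\theta)$ to its descent datum $(R,\sigma)$ is an equivalence from the category of covering projections $(X,R,\theta)$ trivialized by some consistent $S_\bullet$-descent datum on $R$ to the category of descent data $(R,\sigma)$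 that are covering projections trivialized by some consistent $S_\bullet$-descent datum on $R$; and the latter category is isomorphic to the category of left actions of $\mathbf{G}$. The isomorphism sends $(R,\sigma)$ to an action on the family $R$ in which each $\ell\in S_1$ acts by $s_\ell$, where $(s_\ell)$ is a consistent $S_\bullet$-descent datum that trivializes $(R,\sigma)$, and it sends a morphism, which is a family of functions $R_i\to R'_i$, to the same family of functions. -/

import Mathlib

open CategoryTheory Limits Opposite

universe u w

/-- A Grothendieck topos over `Type u`: a category equivalent to the category of sheaves of
sets on a small site. -/
class IsGrothendieckTopos (E : Type w) [Category.{u} E] : Prop where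
  exists_site : ∃ (C : Type u) (_ : SmallCategory C) (J : GrothendieckTopology C),
    Nonempty (E ≌ Sheaf J (Type u))

namespace SpanTopos

section Topos

variable (E : Type w) [Category.{u} E] [IsGrothendieckTopos E]

instance hasLimits : HasLimits E := by
  obtain ⟨C, _, J, ⟨e⟩⟩ := IsGrothendieckTopos.exists_site (E := E)
  exact Adjunction.has_limits_of_equivalence e.functor

instance hasColimits : HasColimits E := by
  obtain ⟨C, _, J, ⟨e⟩⟩ := IsGrothendieckTopos.exists_site (E := E)
  have : HasColimitsOfSize.{u, u} (Sheaf J (Type u)) := Sheaf.instHasColimitsOfSize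
  exact Adjunction.has_colimits_of_equivalence e.functor

instance hasLimitsZero : HasLimitsOfSize.{0, 0} E := hasLimitsOfSizeShrink.{0, 0, u, u} E

instance hasFiniteLimits : HasFiniteLimits E := hasFiniteLimits_of_hasLimits E

instance hasTerminal : HasTerminal E := inferInstance

instance hasPullbacks : HasPullbacks E := inferInstance

instance hasBinaryProducts : HasBinaryProducts E := inferInstance

instance hasCoproducts : HasCoproducts.{u} E := fun _ => hasColimits E |>.has_colimits_of_shape _

/-- The inverse image `γ*` of the geometric morphism `γ : E ⟶ Sets`: it sends a set to the
coproduct of as many copies of the terminal object. -/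
noncomputable def gammaStar : Type u ⥤ E := sigmaConst.{u}.obj (⊤_ E)

end Topos

noncomputable section

attribute [local simp] Limits.prod.lift_fst Limits.prod.lift_snd Limits.prod.lift_fst_assoc
  Limits.prod.lift_snd_assoc

variable {E : Type w} [Category.{u} E] [IsGrothendieckTopos E]

/-- The point of `γ* S` given by an element `s` of `S`. -/
def gammaPoint {S : Type u} (s : S) : ⊤_ E ⟶ (gammaStar E).obj S :=
  Sigma.ι (fun _ : S => ⊤_ E) s

lemma gammaPoint_map {S T : Type u} (f : S ⟶ T) (s : S) :
    gammaPoint s ≫ (gammaStar E).map f = gammaPoint (f s) := by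
  simp [gammaPoint, gammaStar]

/-- The map `γ* R ⟶ γ* R'` given by a function `R → R'`. -/
abbrev gammaMap {R R' : Type u} (f : R → R') : (gammaStar E).obj R ⟶ (gammaStar E).obj R' :=
  (gammaStar E).map (TypeCat.ofHom f)

/-- The component `H_s` of `ζ : H ⟶ γ* S` at `s`, that is, the fibre of `ζ` at the point `s`. -/
def component {S : Type u} {H : E} (ζ : H ⟶ (gammaStar E).obj S) (s : S) : E :=
  pullback ζ (gammaPoint s)

/-- The map `H_s ⟶ H'_{s'}` between components which is induced by a map of families `(f, α)`,
where `α s = s'`. -/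
def componentMap {S S' : Type u} {H H' : E} {ζ : H ⟶ (gammaStar E).obj S}
    {ζ' : H' ⟶ (gammaStar E).obj S'} (f : H ⟶ H') (α : S ⟶ S')
    (comm : f ≫ ζ' = ζ ≫ (gammaStar E).map α) {s : S} {s' : S'} (h : α s = s') :
    component ζ s ⟶ component ζ' s' :=
  show pullback ζ (gammaPoint s) ⟶ pullback ζ' (gammaPoint s') from pullback.lift (pullback.fst ζ (gammaPoint s) ≫ f) (pullback.snd ζ (gammaPoint s)) (by
    subst h
    rw [Category.assoc, comm, pullback.condition_assoc, gammaPoint_map])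

variable (E) in
/-- A family `ζ : U ⟶ γ* I` in the topos `E` with non-empty (that is, non-initial) components. -/
structure Family where
  /-- the set of indices -/
  I : Type u
  /-- the total object -/
  U : E
  /-- the structure map -/
  ζ : U ⟶ (gammaStar E).obj I
  nonempty : ∀ i, IsEmpty (IsInitial (component ζ i))

namespace Family

variable (𝒰 : Family E)

/-- The component `U_i`. -/
abbrev comp (i : 𝒰.I) : E := component 𝒰.ζ i

/-- The family is a cover when `U ⟶ 1` is an epimorphism. -/
def IsCover : Prop := Epi (terminal.from 𝒰.U)

end Family

/-! ### Locally constant objects and descent data -/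

variable {𝒰 : Family E}

variable (𝒰) in
/-- A locally constant object trivialized by `𝒰`: an object `X` with a trivialization structure
`θ_i : γ* R_i × U_i ≅ X × U_i` over `U_i`, where `R ⟶ I` is a family of sets. -/
structure LocConst where
  /-- the underlying object -/
  X : E
  /-- the family of sets -/
  R : 𝒰.I → Type u
  /-- the trivialization -/
  θ : ∀ i, (gammaStar E).obj (R i) ⨯ 𝒰.comp i ≅ X ⨯ 𝒰.comp i
  θ_snd : ∀ i, (θ i).hom ≫ prod.snd = prod.snd

/-- Morphisms of locally constant objects: a map `X ⟶ X'` and a map `R ⟶ R'` of sets over `I`,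
compatible with the trivializations. -/
@[ext]
structure LocConst.Hom (A B : LocConst 𝒰) where
  /-- the map of underlying objects -/
  f : A.X ⟶ B.X
  /-- the map of families of sets -/
  φ : ∀ i, A.R i → B.R i
  comm : ∀ i, (A.θ i).hom ≫ prod.map f (𝟙 _) = prod.map (gammaMap (φ i)) (𝟙 _) ≫ (B.θ i).hom

lemma gammaMap_id (R : Type u) :
    gammaMap (E := E) (fun x : R => x) = 𝟙 _ :=
  (gammaStar E).map_id R

lemma gammaMap_comp {R R' R'' : Type u} (f : R → R') (g : R' → R'') :
    gammaMap (E := E) (fun x => g (f x)) = gammaMap f ≫ gammaMap g :=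
  (gammaStar E).map_comp (TypeCat.ofHom f) (TypeCat.ofHom g)

instance : Category.{u} (LocConst 𝒰) where
  Hom := LocConst.Hom
  id A := ⟨𝟙 _, fun _ x => x, fun i => by simp [gammaMap_id]⟩
  comp {A B C} g h := ⟨g.f ≫ h.f, fun i x => h.φ i (g.φ i x), fun i => by
    have e₁ : prod.map (g.f ≫ h.f) (𝟙 (𝒰.comp i)) = prod.map g.f (𝟙 _) ≫ prod.map h.f (𝟙 _) := by
      simp
    have e₂ : prod.map (gammaMap (fun x => h.φ i (g.φ i x))) (𝟙 (𝒰.comp i))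
        = prod.map (gammaMap (g.φ i)) (𝟙 _) ≫ prod.map (gammaMap (h.φ i)) (𝟙 _) := by
      rw [gammaMap_comp]; simp
    rw [e₁, e₂, ← Category.assoc, g.comm, Category.assoc, h.comm, Category.assoc]⟩

variable (𝒰) in
/-- A descent datum for the Čech simplicial family of `𝒰` on the object `γ* R ×_{γ* I} U ⟶ U`.
The isomorphisms `σ_{j,i}` lie over the symmetry `U_i × U_j ≅ U_j × U_i`. The identity and cocycle
conditions are stated for generalized elements `a` of `γ* R_i` and `x`, `y`, `z` of `U_i`, `U_j`,
`U_k`. Pairs and triples with empty product `U_i × U_j`, `U_i × U_j × U_k` need not be left out,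
since for them the datum is unique and the conditions are void (the initial object is strict). -/
@[ext]
structure DescentDatum where
  /-- the family of sets -/
  R : 𝒰.I → Type u
  /-- the isomorphisms -/
  σ : ∀ i j, (gammaStar E).obj (R i) ⨯ (𝒰.comp i ⨯ 𝒰.comp j) ≅
    (gammaStar E).obj (R j) ⨯ (𝒰.comp j ⨯ 𝒰.comp i)
  isOver : ∀ i j, (σ i j).hom ≫ prod.snd = prod.snd ≫ (Limits.prod.braiding _ _).hom
  identity : ∀ (i : 𝒰.I) {T : E} (a : T ⟶ (gammaStar E).obj (R i)) (x : T ⟶ 𝒰.comp i),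
    prod.lift a (prod.lift x x) ≫ (σ i i).hom = prod.lift a (prod.lift x x)
  cocycle : ∀ (i j k : 𝒰.I) {T : E} (a : T ⟶ (gammaStar E).obj (R i))
    (x : T ⟶ 𝒰.comp i) (y : T ⟶ 𝒰.comp j) (z : T ⟶ 𝒰.comp k),
    prod.lift (prod.lift a (prod.lift x y) ≫ (σ i j).hom ≫ prod.fst) (prod.lift y z) ≫
      (σ j k).hom ≫ prod.fst =
    prod.lift a (prod.lift x z) ≫ (σ i k).hom ≫ prod.fst

/-- Morphisms of descent data: maps `R ⟶ R'` of sets over `I` compatible with the data. -/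
@[ext]
structure DescentDatum.Hom (A B : DescentDatum 𝒰) where
  /-- the map of families of sets -/
  φ : ∀ i, A.R i → B.R i
  comm : ∀ i j, (A.σ i j).hom ≫ prod.map (gammaMap (φ j)) (𝟙 _) =
    prod.map (gammaMap (φ i)) (𝟙 _) ≫ (B.σ i j).hom

instance : Category.{u} (DescentDatum 𝒰) where
  Hom := DescentDatum.Hom
  id A := ⟨fun _ x => x, fun i j => by simp [gammaMap_id]⟩
  comp {A B C} g h := ⟨fun i x => h.φ i (g.φ i x), fun i j => by
    have e : ∀ i (V : E), prod.map (gammaMap (fun x => h.φ i (g.φ i x))) (𝟙 V)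
        = prod.map (gammaMap (g.φ i)) (𝟙 _) ≫ prod.map (gammaMap (h.φ i)) (𝟙 _) := by
      intro i V
      rw [gammaMap_comp]; simp
    rw [e, e, ← Category.assoc, g.comm, Category.assoc, h.comm, Category.assoc]⟩

variable (𝒰) in
/-- The functor sending a descent datum to the set `R_i`. -/
def fibre (i : 𝒰.I) : DescentDatum 𝒰 ⥤ Type u where
  obj D := D.R i
  map g := TypeCat.ofHom (DescentDatum.Hom.φ g i)

namespace LocConst

variable (A : LocConst 𝒰)

/-- `θ_i × U_j`. -/
def θProd (i j : 𝒰.I) : (gammaStar E).obj (A.R i) ⨯ (𝒰.comp i ⨯ 𝒰.comp j) ≅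
    A.X ⨯ (𝒰.comp i ⨯ 𝒰.comp j) :=
  (Limits.prod.associator _ _ _).symm ≪≫ prod.mapIso (A.θ i) (Iso.refl _) ≪≫ Limits.prod.associator _ _ _

/-- The descent isomorphism `σ_{j,i}`, determined by
`(θ_j × U_i) ∘ σ_{j,i} = (X × symmetry) ∘ (θ_i × U_j)`. -/
def σ (i j : 𝒰.I) : (gammaStar E).obj (A.R i) ⨯ (𝒰.comp i ⨯ 𝒰.comp j) ≅
    (gammaStar E).obj (A.R j) ⨯ (𝒰.comp j ⨯ 𝒰.comp i) :=
  A.θProd i j ≪≫ prod.mapIso (Iso.refl _) (Limits.prod.braiding _ _) ≪≫ (A.θProd j i).symm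

lemma lift_θ {i : 𝒰.I} {T : E} (a : T ⟶ (gammaStar E).obj (A.R i)) (x : T ⟶ 𝒰.comp i) :
    prod.lift a x ≫ (A.θ i).hom = prod.lift (prod.lift a x ≫ (A.θ i).hom ≫ prod.fst) x := by
  ext <;> simp [A.θ_snd]

lemma θ_inv_snd (i : 𝒰.I) : (A.θ i).inv ≫ prod.snd = prod.snd := by
  rw [Iso.inv_comp_eq, A.θ_snd]

lemma lift_θ_inv {i : 𝒰.I} {T : E} (a : T ⟶ A.X) (x : T ⟶ 𝒰.comp i) :
    prod.lift a x ≫ (A.θ i).inv = prod.lift (prod.lift a x ≫ (A.θ i).inv ≫ prod.fst) x := by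
  ext <;> simp [A.θ_inv_snd]

lemma lift_θProd {i j : 𝒰.I} {T : E} (a : T ⟶ (gammaStar E).obj (A.R i)) (x : T ⟶ 𝒰.comp i)
    (y : T ⟶ 𝒰.comp j) :
    prod.lift a (prod.lift x y) ≫ (A.θProd i j).hom =
      prod.lift (prod.lift a x ≫ (A.θ i).hom ≫ prod.fst) (prod.lift x y) := by
  have h : prod.lift a (prod.lift x y) ≫ (Limits.prod.associator _ _ _).inv
      = prod.lift (prod.lift a x) y := by
    ext <;> simp
  have h' := A.lift_θ a x
  simp only [θProd, Iso.trans_hom, Iso.symm_hom, prod.mapIso_hom, Iso.refl_hom]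
  rw [reassoc_of% h, prod.lift_map_assoc, h']
  ext <;> simp

lemma lift_θProd_inv {i j : 𝒰.I} {T : E} (a : T ⟶ A.X) (x : T ⟶ 𝒰.comp i)
    (y : T ⟶ 𝒰.comp j) :
    prod.lift a (prod.lift x y) ≫ (A.θProd i j).inv =
      prod.lift (prod.lift a x ≫ (A.θ i).inv ≫ prod.fst) (prod.lift x y) := by
  rw [Iso.comp_inv_eq, lift_θProd]
  congr 1
  rw [← reassoc_of% A.lift_θ_inv a x]
  simp

lemma lift_σ {i j : 𝒰.I} {T : E} (a : T ⟶ (gammaStar E).obj (A.R i)) (x : T ⟶ 𝒰.comp i)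
    (y : T ⟶ 𝒰.comp j) :
    prod.lift a (prod.lift x y) ≫ (A.σ i j).hom =
      prod.lift (prod.lift (prod.lift a x ≫ (A.θ i).hom ≫ prod.fst) y ≫ (A.θ j).inv ≫ prod.fst)
        (prod.lift y x) := by
  have h : prod.lift x y ≫ (Limits.prod.braiding _ _).hom = prod.lift y x := by
    ext <;> simp
  simp only [σ, Iso.trans_hom, Iso.symm_hom, prod.mapIso_hom, Iso.refl_hom]
  rw [reassoc_of% A.lift_θProd a x y, prod.lift_map_assoc, h, Category.comp_id, lift_θProd_inv]

/-- The descent datum of a locally constant object. -/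
def descentDatum : DescentDatum 𝒰 where
  R := A.R
  σ := A.σ
  isOver i j := by
    have h := A.lift_σ (prod.fst (X := (gammaStar E).obj (A.R i)) (Y := 𝒰.comp i ⨯ 𝒰.comp j))
      (prod.snd ≫ prod.fst) (prod.snd ≫ prod.snd)
    have h' : prod.lift (prod.fst (X := (gammaStar E).obj (A.R i)) (Y := 𝒰.comp i ⨯ 𝒰.comp j))
      (prod.lift (prod.snd ≫ prod.fst) (prod.snd ≫ prod.snd)) = 𝟙 _ := by
      ext <;> simp
    rw [h', Category.id_comp] at h
    rw [h]
    ext <;> simp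
  identity i T a x := by
    rw [lift_σ, ← reassoc_of% A.lift_θ a x]
    simp
  cocycle i j k T a x y z := by
    have h₁ := A.lift_σ a x y
    have h₂ := A.lift_σ a x z
    rw [reassoc_of% h₁, reassoc_of% h₂, prod.lift_fst, prod.lift_fst,
      reassoc_of% A.lift_σ (prod.lift (prod.lift a x ≫ (A.θ i).hom ≫ prod.fst) y ≫
        (A.θ j).inv ≫ prod.fst) y z, prod.lift_fst, ← reassoc_of% A.lift_θ_inv]
    simp

end LocConst

lemma LocConst.Hom.comm_σ {A B : LocConst 𝒰} (g : LocConst.Hom A B) (i j : 𝒰.I) :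
    (A.σ i j).hom ≫ prod.map (gammaMap (g.φ j)) (𝟙 _) =
      prod.map (gammaMap (g.φ i)) (𝟙 _) ≫ (B.σ i j).hom := by
  have hθ : ∀ i j, (A.θProd i j).hom ≫ prod.map g.f (𝟙 _) =
      prod.map (gammaMap (g.φ i)) (𝟙 _) ≫ (B.θProd i j).hom := by
    intro i j
    have key : ∀ {T : E} (a : T ⟶ (gammaStar E).obj (A.R i)) (x : T ⟶ 𝒰.comp i)
        (y : T ⟶ 𝒰.comp j), prod.lift a (prod.lift x y) ≫ (A.θProd i j).hom ≫
          prod.map g.f (𝟙 _) = prod.lift a (prod.lift x y) ≫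
          prod.map (gammaMap (g.φ i)) (𝟙 _) ≫ (B.θProd i j).hom := by
      intro T a x y
      rw [reassoc_of% A.lift_θProd a x y, prod.lift_map, prod.lift_map_assoc, Category.comp_id,
        B.lift_θProd]
      congr 1
      have := congrArg (fun m => prod.lift a x ≫ m ≫ prod.fst) (g.comm i)
      simpa [prod.lift_map_assoc] using this
    have h := key (prod.fst (X := (gammaStar E).obj (A.R i)) (Y := 𝒰.comp i ⨯ 𝒰.comp j))
      (prod.snd ≫ prod.fst) (prod.snd ≫ prod.snd)
    have h' : prod.lift (prod.fst (X := (gammaStar E).obj (A.R i)) (Y := 𝒰.comp i ⨯ 𝒰.comp j))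
      (prod.lift (prod.snd ≫ prod.fst) (prod.snd ≫ prod.snd)) = 𝟙 _ := by
      ext <;> simp
    rwa [h', Category.id_comp, Category.id_comp] at h
  have hθ' : (A.θProd j i).inv ≫ prod.map (gammaMap (g.φ j)) (𝟙 _) =
      prod.map g.f (𝟙 _) ≫ (B.θProd j i).inv := by
    rw [Iso.inv_comp_eq, ← Category.assoc, hθ, Category.assoc, Iso.hom_inv_id, Category.comp_id]
  simp only [LocConst.σ, Iso.trans_hom, Iso.symm_hom, prod.mapIso_hom, Iso.refl_hom,
    Category.assoc]
  rw [hθ', ← reassoc_of% hθ i j]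
  simp

variable (𝒰) in
/-- The functor sending a locally constant object to its descent datum. -/
def descentFunctor : LocConst 𝒰 ⥤ DescentDatum 𝒰 where
  obj A := A.descentDatum
  map g := ⟨LocConst.Hom.φ g, LocConst.Hom.comm_σ g⟩

namespace DescentDatum

variable (D : DescentDatum 𝒰)

/-- The span `U_i ⟵ V ⟶ U_j` is an action span for the locally constant object determined by
the descent datum. -/
def IsActionSpan {i j : 𝒰.I} {V : E} (p : V ⟶ 𝒰.comp i) (q : V ⟶ 𝒰.comp j) : Prop :=
  IsEmpty (IsInitial V) ∧ ∃ s : D.R i ≃ D.R j,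
    prod.map (𝟙 _) (prod.lift p q) ≫ (D.σ i j).hom =
      prod.map (gammaMap s) (𝟙 V) ≫ prod.map (𝟙 _) (prod.lift q p)

/-- The locally constant object determined by the descent datum is a covering projection: for
all `i`, `j` with `U_i × U_j` non-empty, the family of all `(p, q) : V ⟶ U_i × U_j` with
`(V, p, q)` an action span is (jointly) epimorphic. -/
def IsCoveringProjection : Prop :=
  ∀ i j : 𝒰.I, IsEmpty (IsInitial (𝒰.comp i ⨯ 𝒰.comp j)) →
    ∀ {Z : E} (f g : 𝒰.comp i ⨯ 𝒰.comp j ⟶ Z),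
      (∀ (V : E) (p : V ⟶ 𝒰.comp i) (q : V ⟶ 𝒰.comp j), D.IsActionSpan p q →
        prod.lift p q ≫ f = prod.lift p q ≫ g) → f = g

end DescentDatum

/-! ### Simplicial families -/

section

open Simplicial

/-- A strict duality of a simplicial object: a contravariant simplicial isomorphism to itself
which is the identity in degree zero. -/
structure StrictDuality {C : Type*} [Category* C] (X : SimplicialObject C) where
  /-- the isomorphisms -/
  τ : ∀ n : ℕ, X _⦋n⦌ ≅ X _⦋n⦌
  δ : ∀ (n : ℕ) (i : Fin (n + 2)), (τ (n + 1)).hom ≫ X.δ i = X.δ i.rev ≫ (τ n).hom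
  σ : ∀ (n : ℕ) (i : Fin (n + 1)), (τ n).hom ≫ X.σ i = X.σ i.rev ≫ (τ (n + 1)).hom
  zero : τ 0 = Iso.refl _

variable (E) in
/-- A simplicial family `ζ : H ⟶ γ* S`: a simplicial object of `E` indexed by a simplicial set,
with non-empty components. -/
structure SimplicialFamily where
  /-- the index simplicial set -/
  S : SSet.{u}
  /-- the simplicial object -/
  H : SimplicialObject E
  /-- the structure map -/
  ζ : H ⟶ ((SimplicialObject.whiskering _ _).obj (gammaStar E)).obj S
  nonempty : ∀ (n : ℕ) (s : S _⦋n⦌),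
    IsEmpty (IsInitial (component (S := S _⦋n⦌) (ζ.app (op ⦋n⦌)) s))

end

namespace SimplicialFamily

section

open Simplicial

variable (ℋ : SimplicialFamily E)

/-- The family `H_n ⟶ γ* S_n`. -/
abbrev fam (n : ℕ) : Family E := ⟨ℋ.S _⦋n⦌, ℋ.H _⦋n⦌, ℋ.ζ.app (op ⦋n⦌), ℋ.nonempty n⟩

/-- The family `U = H_0 ⟶ γ* S_0 = γ* I`. -/
abbrev base : Family E := ℋ.fam 0

/-- Self-dualities of a simplicial family: compatible strict dualities of the simplicial object
and of the index simplicial set. -/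
structure SelfDuality where
  /-- the duality of the simplicial set -/
  onS : StrictDuality ℋ.S
  /-- the duality of the simplicial object -/
  onH : StrictDuality ℋ.H
  comm : ∀ n : ℕ, (onH.τ n).hom ≫ ℋ.ζ.app (op ⦋n⦌) =
    ℋ.ζ.app (op ⦋n⦌) ≫ (gammaStar E).map (onS.τ n).hom

/-- `ℋ` is a hypercover refinement of the Čech simplicial family of `base`: `base` is a cover, and
all the maps `H_{n+1} ⟶ (cosk_n H)_{n+1}` are epimorphisms. -/
structure IsHypercover : Prop where
  cover : ℋ.base.IsCover
  epi : ∀ n : ℕ, Epi (((SimplicialObject.coskAdj n).unit.app ℋ.H).app (op ⦋n + 1⦌))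

variable {ℋ}

/-- The object `(H_1)_ℓ`. -/
abbrev obj₁ {i j : ℋ.S _⦋0⦌} (ℓ : ℋ.S.Edge i j) : E := (ℋ.fam 1).comp ℓ.edge

/-- The left leg `(d_1)_ℓ : (H_1)_ℓ ⟶ (H_0)_i` of the span of `ℓ : i ⟶ j`. -/
def src {i j : ℋ.S _⦋0⦌} (ℓ : ℋ.S.Edge i j) : obj₁ ℓ ⟶ ℋ.base.comp i :=
  componentMap (ℋ.H.δ 1) (ℋ.S.δ 1) (ℋ.ζ.naturality (SimplexCategory.δ 1).op) ℓ.src_eq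

/-- The right leg `(d_0)_ℓ : (H_1)_ℓ ⟶ (H_0)_j` of the span of `ℓ : i ⟶ j`. -/
def tgt {i j : ℋ.S _⦋0⦌} (ℓ : ℋ.S.Edge i j) : obj₁ ℓ ⟶ ℋ.base.comp j :=
  componentMap (ℋ.H.δ 0) (ℋ.S.δ 0) (ℋ.ζ.naturality (SimplexCategory.δ 0).op) ℓ.tgt_eq

/-- A morphism from the span of `ℓ` to the span of `t` exists. -/
def SpanLE {i j : ℋ.S _⦋0⦌} (ℓ t : ℋ.S.Edge i j) : Prop :=
  ∃ k : obj₁ ℓ ⟶ obj₁ t, k ≫ src t = src ℓ ∧ k ≫ tgt t = tgt ℓ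

namespace SelfDuality

variable (τ : ℋ.SelfDuality)

/-- The edge `ℓ^op : j ⟶ i` of an edge `ℓ : i ⟶ j`. -/
def opEdge {i j : ℋ.S _⦋0⦌} (ℓ : ℋ.S.Edge i j) : ℋ.S.Edge j i :=
  SSet.Edge.mk ((τ.onS.τ 1).hom ℓ.edge)
    (by
      have h := ConcreteCategory.congr_hom (τ.onS.δ 0 1) ℓ.edge
      simpa [τ.onS.zero, show (Fin.rev 1 : Fin 2) = 0 from rfl] using h)
    (by
      have h := ConcreteCategory.congr_hom (τ.onS.δ 0 0) ℓ.edge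
      simpa [τ.onS.zero, show (Fin.rev 0 : Fin 2) = 1 from rfl] using h)

/-- The map `(τ_1)_ℓ : (H_1)_ℓ ⟶ (H_1)_{ℓ^op}`. -/
def onObj₁ {i j : ℋ.S _⦋0⦌} (ℓ : ℋ.S.Edge i j) : obj₁ ℓ ⟶ obj₁ (τ.opEdge ℓ) :=
  componentMap (ζ := (ℋ.fam 1).ζ) (ζ' := (ℋ.fam 1).ζ) (τ.onH.τ 1).hom (τ.onS.τ 1).hom
    (τ.comm 1) rfl

/-- Condition G: for all `ℓ : i ⟶ j` there is a 2-simplex `w` with faces `∂_2 w = ℓ`,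
`∂_0 w = ℓ^op` such that the two legs of the span of `∂_1 w : i ⟶ i` agree. -/
def ConditionG : Prop :=
  ∀ (i j : ℋ.S _⦋0⦌) (ℓ : ℋ.S.Edge i j), ∃ t : ℋ.S.Edge i i,
    Nonempty (SSet.Edge.CompStruct ℓ (τ.opEdge ℓ) t) ∧ src t = tgt t

end SelfDuality

end

/-! ### The G-fundamental groupoid -/

variable (ℋ : SimplicialFamily E)

section

open Simplicial

/-- The vertices of the index simplicial set, as a quiver with arrows the 1-simplices. -/
def Vertex : Type u := ℋ.S _⦋0⦌

instance : Quiver.{u} ℋ.Vertex where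
  Hom i j := SSet.Edge (X := ℋ.S) i j

/-- A vertex as an object of the category of sequences of composable 1-simplices. -/
abbrev pathVertex (i : ℋ.S _⦋0⦌) : Paths ℋ.Vertex := i

/-- A 1-simplex as a sequence of length one. -/
def basicPath {i j : ℋ.S _⦋0⦌} (ℓ : ℋ.S.Edge i j) : ℋ.pathVertex i ⟶ ℋ.pathVertex j :=
  (Paths.of ℋ.Vertex).map ℓ

end

/-- The basic pairs which generate the relation on sequences of composable 1-simplices.
Arrows are composed in diagrammatic order. -/
inductive basicRel : HomRel (Paths ℋ.Vertex)
  | ident (i : ℋ.S.obj (op (SimplexCategory.mk 0))) :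
      basicRel (ℋ.basicPath (SSet.Edge.id i)) (𝟙 (ℋ.pathVertex i))
  | comp {i j k : ℋ.S.obj (op (SimplexCategory.mk 0))} (ℓ : ℋ.S.Edge i j)
      (r : ℋ.S.Edge j k) (t : ℋ.S.Edge i k) (w : SSet.Edge.CompStruct ℓ r t) :
      basicRel (ℋ.basicPath t) (ℋ.basicPath ℓ ≫ ℋ.basicPath r)
  | span {i j : ℋ.S.obj (op (SimplexCategory.mk 0))} (ℓ t : ℋ.S.Edge i j) (h : SpanLE ℓ t) :
      basicRel (ℋ.basicPath ℓ) (ℋ.basicPath t)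

section

open Simplicial

/-- The G-fundamental groupoid of the simplicial family: the fundamental category of the index
simplicial set, with 1-simplices identified when there is a morphism between their spans. -/
abbrev FundGroupoid : Type u := CategoryTheory.Quotient (C := Paths ℋ.Vertex) ℋ.basicRel

/-- A vertex as an object of the G-fundamental groupoid. -/
def vertex (i : ℋ.S _⦋0⦌) : ℋ.FundGroupoid := ⟨(i : ℋ.Vertex)⟩

/-! ### Descent data of simplicial sets -/

/-- An `S`-descent datum on a family of sets `R ⟶ S_0`. -/
structure _root_.SpanTopos.SDescentDatum (S : SSet.{u}) (R : S _⦋0⦌ → Type u) where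
  /-- the bijections -/
  s : ∀ {i j : S _⦋0⦌}, S.Edge i j → (R i ≃ R j)
  id : ∀ i, s (SSet.Edge.id i) = Equiv.refl (R i)
  comp : ∀ {i j k : S _⦋0⦌} {ℓ : S.Edge i j} {r : S.Edge j k} {t : S.Edge i k},
    SSet.Edge.CompStruct ℓ r t → s t = (s ℓ).trans (s r)

variable {ℋ}
variable {R : ℋ.S _⦋0⦌ → Type u}

/-- An `S`-descent datum is consistent when `s_ℓ = s_t` as soon as there is a morphism of spans
from the span of `ℓ` to the span of `t`. -/
def Consistent (s : SDescentDatum ℋ.S R) : Prop :=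
  ∀ {i j : ℋ.S _⦋0⦌} (ℓ t : ℋ.S.Edge i j), SpanLE ℓ t → s.s ℓ = s.s t

/-- The functor on sequences of composable 1-simplices given by an `S`-descent datum. -/
def pathAction (s : SDescentDatum ℋ.S R) : Paths ℋ.Vertex ⥤ Type u :=
  Paths.lift (V := ℋ.Vertex)
    { obj := fun i => R i
      map := fun ℓ => TypeCat.ofHom (s.s (i := _) (j := _) ℓ) }

lemma pathAction_basicPath (s : SDescentDatum ℋ.S R) {i j : ℋ.S _⦋0⦌} (ℓ : ℋ.S.Edge i j) :
    (pathAction s).map (ℋ.basicPath ℓ) =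
      (show (pathAction s).obj (ℋ.pathVertex i) ⟶ (pathAction s).obj (ℋ.pathVertex j) from
        TypeCat.ofHom (s.s ℓ)) :=
  Paths.lift_toPath _ _

/-- The left action of the G-fundamental groupoid, that is, the set-valued functor, which is given
by a consistent `S`-descent datum: `i` is sent to `R_i` and the class of `ℓ` to `s_ℓ`. -/
def action (s : SDescentDatum ℋ.S R) (hs : Consistent s) : ℋ.FundGroupoid ⥤ Type u :=
  CategoryTheory.Quotient.lift ℋ.basicRel (pathAction s)
    (by
      rintro _ _ _ _ (i | ⟨ℓ, r, t, w⟩ | ⟨ℓ, t, h⟩)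
      · rw [pathAction_basicPath, s.id]
        exact ((pathAction s).map_id (ℋ.pathVertex i)).symm
      · rw [Functor.map_comp, pathAction_basicPath, pathAction_basicPath, pathAction_basicPath,
          s.comp w]
        rfl
      · rw [pathAction_basicPath, pathAction_basicPath, hs ℓ t h])

/-- The map `(h_1)_ℓ = ((d_1)_ℓ, (d_0)_ℓ) : (H_1)_ℓ ⟶ U_i × U_j`. -/
def h₁ {i j : ℋ.S _⦋0⦌} (ℓ : ℋ.S.Edge i j) : obj₁ ℓ ⟶ ℋ.base.comp i ⨯ ℋ.base.comp j :=
  prod.lift (src ℓ) (tgt ℓ)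

namespace SelfDuality

variable (τ : ℋ.SelfDuality)

/-- `σℓ : γ* R_i × (H_1)_ℓ ⟶ γ* R_j × (H_1)_{ℓ^op}` is the member at `ℓ` of the `H`-descent
datum which corresponds to the Čech descent datum `D`: it lies over `(τ_1)_ℓ` and
`σ_{j,i} ∘ (γ* R_i × (h_1)_ℓ) = (γ* R_j × (h_1)_{ℓ^op}) ∘ σℓ`. -/
def Corresponds (D : DescentDatum ℋ.base) {i j : ℋ.S _⦋0⦌} (ℓ : ℋ.S.Edge i j)
    (σℓ : (gammaStar E).obj (D.R i) ⨯ obj₁ ℓ ⟶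
      (gammaStar E).obj (D.R j) ⨯ obj₁ (τ.opEdge ℓ)) : Prop :=
  σℓ ≫ prod.snd = prod.snd ≫ τ.onObj₁ ℓ ∧
    prod.map (𝟙 _) (h₁ ℓ) ≫ (D.σ i j).hom = σℓ ≫ prod.map (𝟙 _) (h₁ (τ.opEdge ℓ))

/-- The descent datum `D` is trivialized by the `S`-descent datum `s`: the corresponding
`H`-descent datum is `γ*(s_ℓ) × (τ_1)_ℓ`. -/
def TrivializedBy (D : DescentDatum ℋ.base) (s : SDescentDatum ℋ.S D.R) : Prop :=
  ∀ {i j : ℋ.S _⦋0⦌} (ℓ : ℋ.S.Edge i j),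
    τ.Corresponds D ℓ (prod.map (gammaMap (s.s ℓ)) (τ.onObj₁ ℓ))

/-- The property of being a covering projection trivialized by a consistent `S`-descent datum
on its family of sets, for locally constant objects determined by a descent datum. -/
def covProj : ObjectProperty (DescentDatum ℋ.base) := fun D =>
  D.IsCoveringProjection ∧ ∃ s : SDescentDatum ℋ.S D.R, Consistent s ∧ τ.TrivializedBy D s

/-- The category of covering projections `(R ⟶ I, σ)`, presented by their descent data, which are
trivialized by a consistent `S`-descent datum. -/
abbrev CovProjData : Type _ := τ.covProj.FullSubcategory

/-- The category of covering projections `(X, R ⟶ I, θ)`, presented by an object of the topos with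
a trivialization structure, which are trivialized by a consistent `S`-descent datum. -/
abbrev CovProj : Type _ :=
  (τ.covProj.inverseImage (descentFunctor ℋ.base)).FullSubcategory

/-- The functor sending a covering projection to its descent datum. -/
def covProjDescent : τ.CovProj ⥤ τ.CovProjData :=
  τ.covProj.lift
    ((τ.covProj.inverseImage (descentFunctor ℋ.base)).ι ⋙ descentFunctor ℋ.base)
    (fun A => A.property)

end SelfDuality

end

end SimplicialFamily

end

end SpanTopos

namespace SpanTopos

/-! ### Coproducts and epimorphisms of sheaves under pullback -/

section Universality

/-! The Čech datum `σ` and a trivializing `S`-descent datum `s` determine each other. Since `H_1`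
maps epimorphically to its 0-coskeleton, the spans of the edges `i ⟶ j` jointly cover `U_i × U_j`
(`eq_of_obj₁_local`). On the piece of `ℓ`, `σ` is the constant bijection `s_ℓ`
(`trivializedBy_iff`). So `s` determines `σ`, and since `(H_1)_ℓ` is non-empty, `σ` determines `s`
(`TrivializedBy.unique`).

Conversely, the maps `γ* s_ℓ` glue. Any triangle of generalized elements of `H_1` is locally filled
by an element of `H_2`, whose index is a 2-simplex of `S` (`eq_of_compStruct`). A triangle with one
degenerate edge shows that two pieces agree where they overlap (`exists_σ`); a general triangle
gives the cocycle condition (`σFst_cocycle`). The result is automatically a covering projection, the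
spans of edges being action spans. The same covering argument shows that morphisms of such descent
data are exactly the families of functions commuting with the `s_ℓ`.

Under condition G, consistent `S`-descent data are functors on the fundamental groupoid. The edge
`∂_1 w` has equal legs, so its span maps to that of a degenerate edge, and `ℓ^op` becomes inverse to
`ℓ` (`isIso_edgeClass`). The family `R` is never changed, which gives an isomorphism of categories
and not merely an equivalence.

The comparison with objects `X` of the topos is effective descent along the cover: `X` is a quotient
of the pieces `γ* R_i × U_i` (`exists_locConst`), and maps descend because epimorphisms are regular
and stable under pullback. Throughout, equality of two maps out of `V` is tested after passing to a
cover of `V`; this rests on universal coproducts, stable epimorphisms and exponentials. -/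

/-- Every element downstairs lies in exactly one summand, and the pullback squares carry this
upstairs; a map out of the new cocone point is then defined through the chosen summand. -/
theorem isUniversalColimit_types {ι : Type*} {F : Discrete ι ⥤ Type u} {c : Cocone F}
    (hc : IsColimit c) : IsUniversalColimit c := by
  intro F' c' α f h _ H
  have hc₀ := (IsColimit.precomposeInvEquiv (Discrete.natIsoFunctor (F := F)) c).symm hc
  have surj : ∀ x : c.pt, ∃ (j : Discrete ι) (y : F.obj j), c.ι.app j y = x := fun x => by
    obtain ⟨i, y, hy⟩ := Cofan.inj_jointly_surjective_of_isColimit hc₀ x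
    exact ⟨⟨i⟩, y, hy⟩
  have inj : ∀ {j j' : Discrete ι} (y : F.obj j) (y' : F.obj j'),
      c.ι.app j y = c.ι.app j' y' → j = j' := fun {j j'} y y' hy => by
    have := Cofan.eq_of_inj_apply_eq_of_isColimit hc₀ (i₁ := j.as) (i₂ := j'.as) y y' hy
    exact Discrete.ext this
  have comm : ∀ (j : Discrete ι) (y : F'.obj j), c.ι.app j (α.app j y) = f (c'.ι.app j y) :=
    fun j y => ConcreteCategory.congr_hom (NatTrans.congr_app h j) y
  have surj' : ∀ x : c'.pt, ∃ p : Σ j : Discrete ι, F'.obj j, c'.ι.app p.1 p.2 = x := fun x => by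
    obtain ⟨j, y, hy⟩ := surj (f x)
    obtain ⟨z, hz, -⟩ := Types.exists_of_isPullback (H j) x y hy.symm
    exact ⟨⟨j, z⟩, hz⟩
  have inj' : ∀ p q : Σ j : Discrete ι, F'.obj j,
      c'.ι.app p.1 p.2 = c'.ι.app q.1 q.2 → p = q := by
    rintro ⟨j, y⟩ ⟨j', y'⟩ (hp : c'.ι.app j y = c'.ι.app j' y')
    obtain rfl : j = j' := inj (α.app j y) (α.app j' y') (by rw [comm, comm, hp])
    obtain rfl : y = y' := by
      apply Types.ext_of_isPullback (H j) hp
      have hc₁ := Cofan.inj_injective_of_isColimit hc₀ j.as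
      apply hc₁
      change c.ι.app j (α.app j y) = c.ι.app j (α.app j y')
      rw [comm, comm, hp]
    rfl
  choose s hs using surj'
  refine ⟨{ desc := fun t => TypeCat.ofHom fun x => t.ι.app (s x).1 (s x).2, fac := ?_, uniq := ?_ }⟩
  · intro t j
    ext y
    have := inj' (s (c'.ι.app j y)) ⟨j, y⟩ (hs _)
    change t.ι.app (s (c'.ι.app j y)).1 (s (c'.ι.app j y)).2 = t.ι.app j y
    rw [this]
  · intro t m hm
    ext x
    change m x = t.ι.app (s x).1 (s x).2
    rw [← hm]
    change m x = m (c'.ι.app (s x).1 (s x).2)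
    rw [hs]

theorem isUniversalColimit_functor {ι : Type*} {C : Type*} [Category* C]
    {F : Discrete ι ⥤ C ⥤ Type u} {c : Cocone F} [HasColimitsOfShape (Discrete ι) (Type u)]
    (hc : IsColimit c) : IsUniversalColimit c := by
  intro F' c' α f e hα H
  refine ⟨evaluationJointlyReflectsColimits _ fun x => ?_⟩
  exact (isUniversalColimit_types (isColimitOfPreserves ((evaluation C (Type u)).obj x) hc)
    (((evaluation C _).obj x).mapCocone c')
    (Functor.whiskerRight α _) (((evaluation C _).obj x).map f)
    (by
      apply NatTrans.ext
      funext y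
      exact NatTrans.congr_app (NatTrans.congr_app e y) x)
    (hα.whiskerRight _) fun j => (H j).map ((evaluation C _).obj x)).some

/-- A coproduct of sheaves is the sheafification of the coproduct of presheaves, and a left exact
reflection preserves universality. -/
theorem isUniversalColimit_sheaf {ι : Type u} {C : Type u} [SmallCategory C]
    (J : GrothendieckTopology C) {F : Discrete ι ⥤ Sheaf J (Type u)} {c : Cocone F}
    (hc : IsColimit c) : IsUniversalColimit c := by
  let adj := sheafificationAdjunction J (Type u)
  let c₀ := colimit.cocone (F ⋙ sheafToPresheaf J (Type u))
  have h₁ : IsUniversalColimit ((presheafToSheaf J (Type u)).mapCocone c₀) :=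
    IsUniversalColimit.map_reflective adj
      (isUniversalColimit_functor (colimit.isColimit (F ⋙ sheafToPresheaf J (Type u))))
  have h₂ : IsColimit ((presheafToSheaf J (Type u)).mapCocone c₀) :=
    isColimitOfPreserves _ (colimit.isColimit _)
  let φ : F ≅ (F ⋙ sheafToPresheaf J (Type u)) ⋙ presheafToSheaf J (Type u) :=
    (Functor.isoWhiskerLeft F (asIso adj.counit) ≪≫ F.rightUnitor).symm
  have h₃ := h₁.precompose_isIso φ.hom
  exact h₃.of_iso (((IsColimit.precomposeHomEquiv φ _).symm h₂).uniqueUpToIso hc)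

/-- Epimorphisms are the locally surjective maps: on the covering sieve where `f s` lifts along `g`,
the pullback square lifts `s` along `p`. -/
theorem epi_of_isPullback_sheaf {C : Type u} [SmallCategory C]
    (J : GrothendieckTopology C) {P X Y Z : Sheaf J (Type u)} {p : P ⟶ X} {q : P ⟶ Y} {f : X ⟶ Z}
    {g : Y ⟶ Z} (h : IsPullback p q f g) [Epi g] : Epi p := by
  rw [← Sheaf.isLocallySurjective_iff_epi]
  have hg : Sheaf.IsLocallySurjective g := (Sheaf.isLocallySurjective_iff_epi g).2 inferInstance
  refine ⟨fun {c} s => ?_⟩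
  refine J.superset_covering ?_ (Presheaf.imageSieve_mem J g.hom (U := op c) (f.hom.app _ s))
  rintro d a ⟨t, ht⟩
  obtain ⟨r, hr, -⟩ := Types.exists_of_isPullback
    ((h.map (sheafToPresheaf J (Type u))).map ((evaluation _ _).obj (op d)))
    (X.obj.map a.op s) t (by
      refine Eq.trans ?_ ht.symm
      exact NatTrans.naturality_apply f.hom a.op s)
  exact ⟨r, hr⟩

end Universality

/-! ### Transfer of exactness properties to an abstract Grothendieck topos -/

section Topos

variable {E : Type w} [Category.{u} E] [IsGrothendieckTopos E]

theorem isUniversalColimit {ι : Type u} {F : Discrete ι ⥤ E} {c : Cocone F}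
    (hc : IsColimit c) : IsUniversalColimit c := by
  obtain ⟨C, _, J, ⟨e⟩⟩ := IsGrothendieckTopos.exists_site (E := E)
  have : PreservesColimitsOfSize.{u, u} e.functor := inferInstance
  have : PreservesColimit F e.functor := PreservesColimitsOfShape.preservesColimit
  have : ReflectsColimitsOfShape (Discrete ι) e.functor := reflectsColimitsOfShape_of_reflectsIsomorphisms
  exact IsUniversalColimit.of_mapCocone e.functor
    (isUniversalColimit_sheaf J (isColimitOfPreserves e.functor hc))

instance balanced : Balanced E := by
  obtain ⟨C, _, J, ⟨e⟩⟩ := IsGrothendieckTopos.exists_site (E := E)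
  refine ⟨fun f _ _ => ?_⟩
  have := isIso_of_mono_of_epi (e.functor.map f)
  exact isIso_of_reflects_iso f e.functor

theorem epi_of_isPullback {P X Y Z : E} {p : P ⟶ X} {q : P ⟶ Y} {f : X ⟶ Z}
    {g : Y ⟶ Z} (h : IsPullback p q f g) [Epi g] : Epi p := by
  obtain ⟨C, _, J, ⟨e⟩⟩ := IsGrothendieckTopos.exists_site (E := E)
  have := epi_of_isPullback_sheaf J (h.map e.functor)
  exact e.functor.epi_of_epi_map this

theorem isRegularEpi {X Y : E} (f : X ⟶ Y) [Epi f] : IsRegularEpi f := by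
  obtain ⟨C, _, J, ⟨e⟩⟩ := IsGrothendieckTopos.exists_site (E := E)
  have h := (IsRegularEpiCategory.regularEpiOfEpi (e.functor.map f))
  rw [isRegularEpi_iff_effectiveEpi] at h ⊢
  exact e.functor.effectiveEpi_of_map f h

theorem exists_exponential (U Z : E) : ∃ (P : E) (ev : P ⨯ U ⟶ Z), ∀ (X : E) (f : X ⨯ U ⟶ Z),
    ∃ g : X ⟶ P, prod.map g (𝟙 U) ≫ ev = f ∧
      ∀ g' : X ⟶ P, prod.map g' (𝟙 U) ≫ ev = f → g' = g := by
  obtain ⟨C, _, J, ⟨e⟩⟩ := IsGrothendieckTopos.exists_site (E := E)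
  let _ : CartesianMonoidalCategory E := CartesianMonoidalCategory.ofHasFiniteProducts
  let _ : MonoidalClosed E := @cartesianClosedOfEquiv _ _ _ _ _ _ e.symm
    (instMonoidalClosedSheafOfHasSheafifyOfFunctorOpposite J (Type u))
  open MonoidalCategory CartesianMonoidalCategory in
  let c (X : E) : X ⨯ U ≅ U ⊗ X :=
    { hom := CartesianMonoidalCategory.lift Limits.prod.snd Limits.prod.fst
      inv := prod.lift (SemiCartesianMonoidalCategory.snd _ _) (SemiCartesianMonoidalCategory.fst _ _)
      hom_inv_id := by
        ext
        · simp
        · simp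
      inv_hom_id := by ext <;> simp [Limits.prod.lift_fst, Limits.prod.lift_snd] }
  have hc : ∀ {X P : E} (g : X ⟶ P),
      prod.map g (𝟙 U) ≫ (c P).hom = (c X).hom ≫ MonoidalCategory.whiskerLeft U g := by
    intro X P g
    ext <;> simp [c]
  refine ⟨(ihom U).obj Z, (c _).hom ≫ (ihom.ev U).app Z, fun X f =>
    ⟨MonoidalClosed.curry ((c X).inv ≫ f), ?_, fun g' hg' => ?_⟩⟩
  · rw [reassoc_of% hc, ← MonoidalClosed.uncurry_eq, MonoidalClosed.uncurry_curry,
      Iso.hom_inv_id_assoc]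
  · rw [MonoidalClosed.eq_curry_iff, MonoidalClosed.uncurry_eq, Iso.eq_inv_comp,
      ← reassoc_of% hc, hg']

/-- The map from the initial object to `T` is mono, as in any topos, and epi by hypothesis;
balancedness makes it invertible. -/
theorem initial_of_forall_eq {T : E} (h : ∀ (Z : E) (f g : T ⟶ Z), f = g) :
    Nonempty (IsInitial T) := by
  obtain ⟨C, _, J, ⟨e⟩⟩ := IsGrothendieckTopos.exists_site (E := E)
  have h₀ : Mono (e.functor.map (initial.to T)) := by
    have : PreservesColimitsOfSize.{0, 0} e.functor := inferInstance
    have : PreservesColimit (Functor.empty E) e.functor :=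
      PreservesColimitsOfShape.preservesColimit
    have hi : IsInitial (e.functor.obj (⊥_ E)) := initialIsInitial.isInitialObj e.functor _
    rw [hi.hom_ext (e.functor.map (initial.to T)) (hi.to _)]
    exact InitialMonoClass.isInitial_mono_from _ hi
  have : Mono (initial.to T) := e.functor.mono_of_mono_map h₀
  have : Epi (initial.to T) := ⟨fun f g _ => h _ f g⟩
  have : IsIso (initial.to T) := isIso_of_mono_of_epi _
  exact ⟨initialIsInitial.ofIso (asIso (initial.to T))⟩

end Topos
end SpanTopos

namespace SpanTopos

noncomputable section

attribute [local simp] Limits.prod.lift_fst Limits.prod.lift_snd Limits.prod.lift_fst_assoc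
  Limits.prod.lift_snd_assoc

/-! ### Local arguments with jointly epimorphic families and constant elements -/

section JointlyEpi

variable {E : Type w} [Category.{u} E]

/-- A family of morphisms with a common codomain is jointly epimorphic. -/
def JointlyEpi {ι : Type*} {A : ι → E} {Y : E} (e : ∀ i, A i ⟶ Y) : Prop :=
  ∀ ⦃Z : E⦄ (f g : Y ⟶ Z), (∀ i, e i ≫ f = e i ≫ g) → f = g

variable [IsGrothendieckTopos E]

/-- By universality `V` is the coproduct of the pullbacks of `y` along the injections. -/
theorem eq_of_sigma_local {ι : Type u} (A : ι → E) {V Z : E} (y : V ⟶ ∐ A) (f g : V ⟶ Z)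
    (h : ∀ (T : E) (t : T ⟶ V) (i : ι) (a : T ⟶ A i), a ≫ Sigma.ι A i = t ≫ y →
      t ≫ f = t ≫ g) : f = g := by
  have hu := isUniversalColimit (coproductIsCoproduct A)
  have hc := (hu (Cofan.mk V (fun i => pullback.fst y (Sigma.ι A i)))
    (Discrete.natTrans fun i => pullback.snd y (Sigma.ι A i.as)) y
    (by ext ⟨i⟩; exact pullback.condition.symm) (.of_discrete _)
    (fun ⟨i⟩ => IsPullback.of_hasPullback y (Sigma.ι A i))).some
  refine hc.hom_ext fun ⟨i⟩ => ?_
  exact h _ (pullback.fst y (Sigma.ι A i)) i (pullback.snd y (Sigma.ι A i)) pullback.condition.symm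

theorem eq_of_epi_local {H Y V Z : E} (e : H ⟶ Y) [Epi e] (y : V ⟶ Y) (f g : V ⟶ Z)
    (h : ∀ (T : E) (t : T ⟶ V) (a : T ⟶ H), a ≫ e = t ≫ y → t ≫ f = t ≫ g) : f = g := by
  have := epi_of_isPullback (IsPullback.of_hasPullback y e)
  rw [← cancel_epi (pullback.fst y e)]
  exact h _ _ (pullback.snd y e) pullback.condition.symm

namespace JointlyEpi

variable {ι : Type u} {A : ι → E} {Y : E} {e : ∀ i, A i ⟶ Y} (he : JointlyEpi e)
include he

theorem epi_desc : Epi (Sigma.desc e) :=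
  ⟨fun f g h => he f g fun i => by simpa using Sigma.ι A i ≫= h⟩

theorem eq_of_local {V Z : E} (y : V ⟶ Y) (f g : V ⟶ Z)
    (h : ∀ (T : E) (t : T ⟶ V) (i : ι) (a : T ⟶ A i), a ≫ e i = t ≫ y → t ≫ f = t ≫ g) :
    f = g := by
  have := he.epi_desc
  refine eq_of_epi_local (Sigma.desc e) y f g fun T t a ha => ?_
  refine eq_of_sigma_local A a _ _ fun T' t' i a' ha' => ?_
  rw [← Category.assoc, ← Category.assoc]
  refine h T' _ i a' ?_
  rw [Category.assoc, ← ha, ← reassoc_of% ha', Sigma.ι_desc]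

/-- `Sigma.desc e` is a regular epimorphism, so it suffices that `Sigma.desc d` coequalizes every
pair that it coequalizes. Locally such a pair factors through two summands `A i`, `A j`, where the
hypothesis applies. -/
theorem exists_desc {Z : E} (d : ∀ i, A i ⟶ Z)
    (h : ∀ (T : E) (i j : ι) (x : T ⟶ A i) (y : T ⟶ A j), x ≫ e i = y ≫ e j →
      x ≫ d i = y ≫ d j) : ∃ m : Y ⟶ Z, ∀ i, e i ≫ m = d i := by
  have := he.epi_desc
  have := isRegularEpi (Sigma.desc e)
  have key : ∀ (W : E) (p q : W ⟶ ∐ A), p ≫ Sigma.desc e = q ≫ Sigma.desc e →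
      p ≫ Sigma.desc d = q ≫ Sigma.desc d := by
    intro W p q hpq
    refine eq_of_sigma_local A p _ _ fun T t i a ha => ?_
    refine eq_of_sigma_local A (t ≫ q) _ _ fun T' t' j b hb => ?_
    have h' := h T' i j (t' ≫ a) b (by
      have h₁ := (t' ≫ t) ≫= hpq
      simp only [Category.assoc] at h₁ hb
      rw [← reassoc_of% ha, ← reassoc_of% hb] at h₁
      simpa using h₁)
    rw [← reassoc_of% ha, ← reassoc_of% hb]
    simpa using h'
  refine ⟨IsRegularEpi.desc (Sigma.desc e) (Sigma.desc d) (key _ _ _ (IsRegularEpi.w _)), fun i => ?_⟩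
  rw [← Sigma.ι_desc e i, Category.assoc, IsRegularEpi.fac, Sigma.ι_desc]

theorem prod_map_left (R : E) : JointlyEpi fun i => prod.map (𝟙 R) (e i) := by
  intro Z f g h
  refine he.eq_of_local prod.snd f g fun T t i a ha => ?_
  have : t = prod.lift (t ≫ prod.fst) a ≫ prod.map (𝟙 R) (e i) := by
    ext <;> simp [ha]
  rw [this, Category.assoc, Category.assoc, h]

end JointlyEpi

theorem jointlyEpi_gammaPoint (S : Type u) :
    JointlyEpi (fun s : S => (gammaPoint s : ⊤_ E ⟶ (gammaStar E).obj S)) :=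
  fun _ f g h => Sigma.hom_ext (f := fun _ : S => ⊤_ E) f g h

/-- The constant map `T ⟶ γ* S` with value `s`. -/
def const (T : E) {S : Type u} (s : S) : T ⟶ (gammaStar E).obj S := terminal.from T ≫ gammaPoint s

theorem comp_const {T T' : E} (t : T' ⟶ T) {S : Type u} (s : S) : t ≫ const T s = const T' s := by
  rw [const, const, ← Category.assoc, terminal.comp_from]

theorem const_map {T : E} {S S' : Type u} (f : S ⟶ S') (s : S) :
    const T s ≫ (gammaStar E).map f = const T (f s) := by
  rw [const, const, Category.assoc, gammaPoint_map]

theorem const_gammaMap {T : E} {S S' : Type u} (f : S → S') (s : S) :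
    const T s ≫ gammaMap f = const T (f s) :=
  const_map _ _

theorem eq_of_const_local {S : Type u} {V Z : E} (y : V ⟶ (gammaStar E).obj S) (f g : V ⟶ Z)
    (h : ∀ (T : E) (t : T ⟶ V) (s : S), t ≫ y = const T s → t ≫ f = t ≫ g) : f = g := by
  refine (jointlyEpi_gammaPoint S).eq_of_local y f g fun T t s a ha => ?_
  obtain rfl : a = terminal.from T := Subsingleton.elim _ _
  exact h T t s ha.symm

/-- Disjointness of the summands of `γ* S`. The alternative that all parallel maps out of `T` agree
is the form in which local arguments dispose of an empty `T`. -/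
theorem eq_or_forall_eq_of_const_eq {T : E} {S : Type u} {s s' : S}
    (h : const T s = const T s') : s = s' ∨ ∀ (Z : E) (f g : T ⟶ Z), f = g := by
  classical
  by_cases hs : s = s'
  · exact Or.inl hs
  refine Or.inr fun Z f g => ?_
  obtain ⟨P, ev, hP⟩ := exists_exponential T Z
  obtain ⟨f', hf', -⟩ := hP (⊤_ E) (prod.snd ≫ f)
  obtain ⟨g', hg', -⟩ := hP (⊤_ E) (prod.snd ≫ g)
  -- With `f`, `g` regarded as points of the exponential `Z^T`, this map takes the value `f` at `s`
  -- and `g` at `s'`, so agreement of the two constants on `T` forces `f = g`.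
  let φ : (gammaStar E).obj S ⟶ P := Sigma.desc fun r => if r = s then f' else g'
  have hφ : ∀ r : S, gammaPoint r ≫ φ = if r = s then f' else g' := fun r =>
    Sigma.ι_desc (f := fun _ : S => ⊤_ E) _ r
  have key : ∀ r : S, prod.lift (const T r) (𝟙 T) ≫ prod.map φ (𝟙 T) ≫ ev =
      if r = s then f else g := by
    intro r
    have h₁ : prod.lift (const T r) (𝟙 T) ≫ prod.map φ (𝟙 T) =
        prod.lift (terminal.from T) (𝟙 T) ≫ prod.map (if r = s then f' else g') (𝟙 T) := by
      ext
      · simp [const, hφ]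
      · simp
    rw [reassoc_of% h₁]
    split_ifs
    · rw [hf']; simp
    · rw [hg']; simp
  have h₁ := key s
  have h₂ := key s'
  rw [if_pos rfl] at h₁
  rw [if_neg (fun h => hs h.symm)] at h₂
  rw [← h₁, ← h₂, h]

theorem eq_of_const_eq {T : E} (hT : IsEmpty (IsInitial T)) {S : Type u} {s s' : S}
    (h : const T s = const T s') : s = s' := by
  rcases eq_or_forall_eq_of_const_eq h with h | h
  · exact h
  · exact (hT.false (initial_of_forall_eq h).some).elim

end JointlyEpi

/-! ### Maps into the components of a family -/

section Component

variable {E : Type w} [Category.{u} E] [IsGrothendieckTopos E]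
variable {S S' : Type u} {H H' : E} (ζ : H ⟶ (gammaStar E).obj S)

/-- The inclusion of a component of a family. -/
def componentι (s : S) : component ζ s ⟶ H := pullback.fst ζ (gammaPoint s)

theorem componentι_comp (s : S) : componentι ζ s ≫ ζ = const _ s := by
  refine (pullback.condition (f := ζ) (g := gammaPoint s)).trans ?_
  rw [const, Subsingleton.elim (terminal.from (component ζ s)) (pullback.snd ζ (gammaPoint s))]
  rfl

variable {ζ}

theorem component_hom_ext {s : S} {T : E} {f g : T ⟶ component ζ s}
    (h : f ≫ componentι ζ s = g ≫ componentι ζ s) : f = g :=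
  pullback.hom_ext h (Subsingleton.elim _ _)

/-- A map into the total object of a family with constant index factors through a component. -/
def componentLift {s : S} {T : E} (f : T ⟶ H) (h : f ≫ ζ = const T s) : T ⟶ component ζ s :=
  pullback.lift f (terminal.from T) h

theorem componentLift_ι {s : S} {T : E} (f : T ⟶ H) (h : f ≫ ζ = const T s) :
    componentLift f h ≫ componentι ζ s = f :=
  pullback.lift_fst _ _ _

theorem componentMap_ι {ζ' : H' ⟶ (gammaStar E).obj S'} (f : H ⟶ H') (α : S ⟶ S')
    (comm : f ≫ ζ' = ζ ≫ (gammaStar E).map α) {s : S} {s' : S'} (h : α s = s') :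
    componentMap f α comm h ≫ componentι ζ' s' = componentι ζ s ≫ f :=
  pullback.lift_fst _ _ _

end Component

end

end SpanTopos

namespace SpanTopos

noncomputable section

open Simplicial

attribute [local simp] Limits.prod.lift_fst Limits.prod.lift_snd Limits.prod.lift_fst_assoc
  Limits.prod.lift_snd_assoc

/-- In the application `r` and `r'` are components of the unit of the coskeleton adjunction, at
`⦋m⦌` and at a truncated object, and `k` is the counit, a left inverse of `r'`. -/
theorem comp_eq_of_split {E : Type w} [Category.{u} E] {T V A A' B B' : E} {a : T ⟶ A}
    {r : A ⟶ B} {t : T ⟶ V} {b : V ⟶ B}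
    {r' : A' ⟶ B'} {k : B' ⟶ A'} {α : A ⟶ A'} {β : B ⟶ B'} {c : V ⟶ A'}
    (h₁ : a ≫ r = t ≫ b) (h₂ : b ≫ β ≫ k = c) (h₃ : α ≫ r' = r ≫ β) (h₄ : r' ≫ k = 𝟙 _) :
    a ≫ α = t ≫ c := by
  rw [← h₂, ← reassoc_of% h₁, ← reassoc_of% h₃, h₄, Category.comp_id]

/-! ### Local fillers for edges and triangles from the hypercover condition -/

section Coskeleton

variable {E : Type w} [Category.{u} E] [IsGrothendieckTopos E] (H : SimplicialObject E)

/-- Compatible data on the simplices of dimension at most `n` of the `m`-simplex. -/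
theorem eq_of_cosk_local (n m : ℕ)
    [Epi (((SimplicialObject.coskAdj n).unit.app H).app (op ⦋m⦌))] {V Z : E}
    (c : ∀ (x : SimplexCategory.Truncated n) (_ : x.obj ⟶ ⦋m⦌), V ⟶ H.obj (op x.obj))
    (hc : ∀ {x y : SimplexCategory.Truncated n} (β : x.obj ⟶ y.obj) (α : y.obj ⟶ ⦋m⦌),
      c y α ≫ H.map β.op = c x (β ≫ α))
    (f g : V ⟶ Z)
    (h : ∀ (T : E) (t : T ⟶ V) (a : T ⟶ H _⦋m⦌),
      (∀ (x : SimplexCategory.Truncated n) (α : x.obj ⟶ ⦋m⦌), a ≫ H.map α.op = t ≫ c x α) →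
      t ≫ f = t ≫ g) : f = g := by
  let L := (SimplexCategory.Truncated.inclusion n).op
  let hl := Functor.isPointwiseRightKanExtensionRanCounit L (L ⋙ H) (op ⦋m⦌)
  let s : Cone (StructuredArrow.proj (op ⦋m⦌) L ⋙ L ⋙ H) :=
    { pt := V
      π := { app := fun p => c p.right.unop p.hom.unop
             naturality := by
              intro p q φ
              have h₁ := hc (x := q.right.unop) (y := p.right.unop) φ.right.unop.hom p.hom.unop
              have h₂ := StructuredArrow.w φ
              refine (Category.id_comp _).trans (Eq.trans ?_ h₁.symm)
              congr 1
              exact congrArg Quiver.Hom.unop h₂.symm } }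
  -- The coskeleton is a pointwise right Kan extension, hence a limit over the truncated simplices
  -- of `⦋m⦌`: compatible data are a map into it, and pulling back the unit gives local fillers.
  let b : V ⟶ ((SimplicialObject.cosk n).obj H).obj (op ⦋m⦌) := hl.lift s
  refine eq_of_epi_local (((SimplicialObject.coskAdj n).unit.app H).app (op ⦋m⦌)) b f g
    fun T t a ha => h T t a fun x α => ?_
  let p : StructuredArrow (op ⦋m⦌) L := StructuredArrow.mk (Y := op x) α.op
  have h₁ : b ≫ ((SimplicialObject.cosk n).obj H).map α.op ≫
      (L.ranCounit.app (L ⋙ H)).app (op x) = c x α := hl.fac s p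
  exact comp_eq_of_split ha h₁ (((SimplicialObject.coskAdj n).unit.app H).naturality α.op)
    (L.ranCounit_app_app_ranAdjunction_unit_app_app H (op x))

theorem eq_of_edge_local
    [Epi (((SimplicialObject.coskAdj 0).unit.app H).app (op ⦋1⦌))] {V Z : E}
    (x y : V ⟶ H _⦋0⦌) (f g : V ⟶ Z)
    (h : ∀ (T : E) (t : T ⟶ V) (a : T ⟶ H _⦋1⦌),
      a ≫ H.δ 1 = t ≫ x → a ≫ H.δ 0 = t ≫ y → t ≫ f = t ≫ g) : f = g := by
  let p : Fin 2 → (V ⟶ H _⦋0⦌) := ![x, y]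
  have hx : ∀ x : SimplexCategory.Truncated 0, x.obj.len = 0 := fun x => Nat.le_zero.1 x.property
  refine eq_of_cosk_local H 0 1
    (fun x α => p (α.toOrderHom 0) ≫ H.map (SimplexCategory.isTerminalZero.from x.obj).op) ?_ f g ?_
  · intro x y β α
    dsimp only
    have h₁ : β.toOrderHom 0 = 0 := by
      have := (β.toOrderHom 0).2
      have := hx y
      ext
      simp
      omega
    have h₂ : (β ≫ α).toOrderHom 0 = α.toOrderHom 0 := by
      rw [← h₁]; rfl
    rw [h₂, Category.assoc, ← H.map_comp, ← op_comp]
    congr 3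
  · intro T t a ha
    have h₀ : SimplexCategory.isTerminalZero.from ⦋0⦌ = 𝟙 _ :=
      SimplexCategory.isTerminalZero.hom_ext _ _
    have h₁ := ha ⟨⦋0⦌, le_rfl⟩ (SimplexCategory.δ 1)
    have h₂ := ha ⟨⦋0⦌, le_rfl⟩ (SimplexCategory.δ 0)
    dsimp only at h₁ h₂
    rw [h₀, op_id, H.map_id, Category.comp_id] at h₁ h₂
    exact h T t a h₁ h₂

theorem eq_zero_or_eq_last {n : ℕ} (hn : n ≤ 1) (i : Fin (n + 1)) : i = 0 ∨ i = Fin.last n := by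
  rcases i with ⟨i, hi⟩
  rcases Nat.lt_or_ge i 1 with h | h
  · left; ext; simp; omega
  · right; ext; simp; omega

theorem simplexCategory_hom_eq {x : SimplexCategory} {m : ℕ} (hx : x.len ≤ 1) {φ ψ : x ⟶ ⦋m⦌}
    (h₀ : φ.toOrderHom 0 = ψ.toOrderHom 0)
    (h₁ : φ.toOrderHom (Fin.last _) = ψ.toOrderHom (Fin.last _)) : φ = ψ := by
  ext1
  ext1
  funext i
  rcases eq_zero_or_eq_last hx i with rfl | rfl
  · exact h₀
  · exact h₁

/-- The map to the 1-simplex which separates the vertex `0` from the others. -/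
def separate (x : SimplexCategory) : x ⟶ ⦋1⦌ :=
  SimplexCategory.Hom.mk ⟨fun i => if i = 0 then 0 else 1, fun i j h => by
    dsimp only
    split_ifs with hi hj hj
    · exact le_rfl
    · exact Fin.zero_le _
    · subst hj
      exact absurd (le_antisymm h (Fin.zero_le _)) hi
    · exact le_rfl⟩

theorem separate_of_ne_zero {x : SimplexCategory} {i : Fin (x.len + 1)} (hi : i ≠ 0) :
    (separate x).toOrderHom i = 1 :=
  if_neg hi

/-- A triangle of edges extends to compatible data on all simplices of dimension at most one of the
2-simplex, vertices receiving degenerate edges. -/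
theorem eq_of_triangle_local
    [Epi (((SimplicialObject.coskAdj 1).unit.app H).app (op ⦋2⦌))] {V Z : E}
    (e₀₁ e₁₂ e₀₂ : V ⟶ H _⦋1⦌) (h₀ : e₀₁ ≫ H.δ 1 = e₀₂ ≫ H.δ 1)
    (h₁ : e₀₁ ≫ H.δ 0 = e₁₂ ≫ H.δ 1) (h₂ : e₁₂ ≫ H.δ 0 = e₀₂ ≫ H.δ 0) (f g : V ⟶ Z)
    (h : ∀ (T : E) (t : T ⟶ V) (a : T ⟶ H _⦋2⦌), a ≫ H.δ 2 = t ≫ e₀₁ → a ≫ H.δ 0 = t ≫ e₁₂ →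
      a ≫ H.δ 1 = t ≫ e₀₂ → t ≫ f = t ≫ g) : f = g := by
  let p : Fin 3 → (V ⟶ H _⦋0⦌) := ![e₀₁ ≫ H.δ 1, e₁₂ ≫ H.δ 1, e₁₂ ≫ H.δ 0]
  -- The entries below the diagonal are fillers; only pairs `a ≤ b` arise from simplices.
  let e : Fin 3 → Fin 3 → (V ⟶ H _⦋1⦌) := fun a b =>
    ![![p 0 ≫ H.σ 0, e₀₁, e₀₂], ![p 0 ≫ H.σ 0, p 1 ≫ H.σ 0, e₁₂],
      ![p 0 ≫ H.σ 0, p 0 ≫ H.σ 0, p 2 ≫ H.σ 0]] a b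
  have ediag : ∀ a, e a a = p a ≫ H.σ 0 := by
    intro a; fin_cases a <;> rfl
  have σδ₁ : H.σ (0 : Fin 1) ≫ H.δ 1 = 𝟙 _ := H.δ_comp_σ_succ (i := (0 : Fin 1))
  have σδ₀ : H.σ (0 : Fin 1) ≫ H.δ 0 = 𝟙 _ := H.δ_comp_σ_self (i := (0 : Fin 1))
  have esrc : ∀ a b, a ≤ b → e a b ≫ H.δ 1 = p a := by
    intro a b hab
    fin_cases a <;> fin_cases b <;>
      first | (exact absurd hab (by decide)) | simp [e, p, σδ₁, h₀]
  have etgt : ∀ a b, a ≤ b → e a b ≫ H.δ 0 = p b := by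
    intro a b hab
    fin_cases a <;> fin_cases b <;>
      first | (exact absurd hab (by decide)) | simp [e, p, σδ₀, h₀, h₁, h₂]
  have hx : ∀ x : SimplexCategory.Truncated 1, x.obj.len ≤ 1 := fun x => x.property
  -- A monotone endomorphism of `⦋1⦌` is the identity or constant, and a constant one replaces an
  -- edge by the degenerate edge at an endpoint.
  have hε : ∀ (ε : ⦋1⦌ ⟶ ⦋1⦌) (a : Fin 2 → Fin 3) (ha : Monotone a),
      e (a 0) (a 1) ≫ H.map ε.op = e (a (ε.toOrderHom 0)) (a (ε.toOrderHom 1)) := by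
    intro ε a ha
    have h01 : ε.toOrderHom 0 ≤ ε.toOrderHom 1 := ε.toOrderHom.monotone (Fin.zero_le _)
    have cases : ∀ i : Fin 2, i = 0 ∨ i = 1 := by decide
    have ha' : a 0 ≤ a 1 := ha (Fin.zero_le _)
    rcases cases (ε.toOrderHom 0) with hi | hi <;> rcases cases (ε.toOrderHom 1) with hj | hj
    · have : ε = SimplexCategory.σ 0 ≫ SimplexCategory.δ 1 :=
        simplexCategory_hom_eq le_rfl hi hj
      rw [hi, hj, this, op_comp, H.map_comp, ediag, ← esrc _ _ ha', Category.assoc]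
      rfl
    · have : ε = 𝟙 _ := simplexCategory_hom_eq le_rfl hi hj
      rw [hi, hj, this, op_id, H.map_id, Category.comp_id]
    · rw [hi, hj] at h01
      exact absurd h01 (by decide)
    · have : ε = SimplexCategory.σ 0 ≫ SimplexCategory.δ 0 :=
        simplexCategory_hom_eq le_rfl hi hj
      rw [hi, hj, this, op_comp, H.map_comp, ediag, ← etgt _ _ ha', Category.assoc]
      rfl
  refine eq_of_cosk_local H 1 2
    -- Restriction along `separate` treats both dimensions at once: it is the identity on `⦋1⦌` and
    -- extracts the source vertex on `⦋0⦌`.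
    (fun x α => e (α.toOrderHom 0) (α.toOrderHom (Fin.last _)) ≫ H.map (separate x.obj).op) ?_ f g ?_
  · intro x y β α
    dsimp only
    -- The endomorphism of `⦋1⦌` through which `β` acts after separation reduces compatibility to
    -- `hε`.
    let ε : ⦋1⦌ ⟶ ⦋1⦌ := SimplexCategory.mkOfLe ((separate y.obj).toOrderHom (β.toOrderHom 0))
      ((separate y.obj).toOrderHom (β.toOrderHom (Fin.last _)))
      ((separate y.obj).toOrderHom.monotone (β.toOrderHom.monotone (Fin.zero_le _)))
    have hβ : β ≫ separate y.obj = separate x.obj ≫ ε := by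
      refine simplexCategory_hom_eq (hx x) rfl ?_
      change (separate y.obj).toOrderHom (β.toOrderHom (Fin.last _)) =
        ε.toOrderHom ((separate x.obj).toOrderHom (Fin.last _))
      by_cases hl : Fin.last x.obj.len = 0
      · rw [hl]; rfl
      · rw [separate_of_ne_zero hl]; rfl
    let a : Fin 2 → Fin 3 := ![α.toOrderHom 0, α.toOrderHom (Fin.last _)]
    have ha : Monotone a := by
      rw [Fin.monotone_iff_le_succ]
      intro i
      fin_cases i
      exact α.toOrderHom.monotone (Fin.zero_le _)
    have hα : ∀ i, a ((separate y.obj).toOrderHom i) = α.toOrderHom i := by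
      intro i
      rcases eq_zero_or_eq_last (hx y) i with rfl | rfl
      · rfl
      · by_cases hl : Fin.last y.obj.len = 0
        · rw [hl]; rfl
        · rw [separate_of_ne_zero hl]; rfl
    rw [Category.assoc, ← H.map_comp, ← op_comp, hβ, op_comp, H.map_comp, ← Category.assoc]
    refine congrArg (· ≫ H.map (separate x.obj).op) ((hε ε a ha).trans ?_)
    exact congrArg₂ e (hα _) (hα _)
  · intro T t a ha
    have h₀ : separate ⦋1⦌ = 𝟙 _ :=
      simplexCategory_hom_eq le_rfl rfl rfl
    have h₁ := fun i => ha ⟨⦋1⦌, le_rfl⟩ (SimplexCategory.δ i)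
    dsimp only at h₁
    rw [h₀, op_id, H.map_id] at h₁
    simp only [Category.comp_id] at h₁
    exact h T t a (h₁ 2) (h₁ 0) (h₁ 1)

end Coskeleton

/-! ### The local covering statements for simplicial families -/

namespace SimplicialFamily

variable {E : Type w} [Category.{u} E] [IsGrothendieckTopos E] {ℋ : SimplicialFamily E}

/-- The structure map in degree `n`. -/
abbrev ζn (ℋ : SimplicialFamily E) (n : ℕ) : ℋ.H _⦋n⦌ ⟶ (gammaStar E).obj (ℋ.S _⦋n⦌) :=
  ℋ.ζ.app (op ⦋n⦌)

theorem δ_ζn {n : ℕ} (i : Fin (n + 2)) :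
    ℋ.H.δ i ≫ ℋ.ζn n = ℋ.ζn (n + 1) ≫ (gammaStar E).map (ℋ.S.δ i) :=
  ℋ.ζ.naturality (SimplexCategory.δ i).op

theorem σ_ζn {n : ℕ} (i : Fin (n + 1)) :
    ℋ.H.σ i ≫ ℋ.ζn (n + 1) = ℋ.ζn n ≫ (gammaStar E).map (ℋ.S.σ i) :=
  ℋ.ζ.naturality (SimplexCategory.σ i).op

theorem const_δ {n : ℕ} (i : Fin (n + 2)) {T : E} {a : T ⟶ ℋ.H _⦋n + 1⦌} {s : ℋ.S _⦋n + 1⦌}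
    (ha : a ≫ ℋ.ζn (n + 1) = const T s) : (a ≫ ℋ.H.δ i) ≫ ℋ.ζn n = const T (ℋ.S.δ i s) := by
  rw [Category.assoc, δ_ζn, reassoc_of% ha]
  exact const_map (ℋ.S.δ i) s

theorem const_component {n : ℕ} {s : ℋ.S _⦋n⦌} {T : E} (a : T ⟶ (ℋ.fam n).comp s) :
    (a ≫ componentι (ℋ.ζn n) s) ≫ ℋ.ζn n = const T s := by
  rw [Category.assoc, componentι_comp]
  exact comp_const _ _

theorem src_ι {i j : ℋ.S _⦋0⦌} (ℓ : ℋ.S.Edge i j) :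
    src ℓ ≫ componentι (ℋ.ζn 0) i = componentι (ℋ.ζn 1) ℓ.edge ≫ ℋ.H.δ 1 :=
  componentMap_ι _ _ _ _

theorem tgt_ι {i j : ℋ.S _⦋0⦌} (ℓ : ℋ.S.Edge i j) :
    tgt ℓ ≫ componentι (ℋ.ζn 0) j = componentι (ℋ.ζn 1) ℓ.edge ≫ ℋ.H.δ 0 :=
  componentMap_ι _ _ _ _

/-- The spans of the edges `i ⟶ j` jointly cover `U_i × U_j`: fill the pair by a local element of
`H_1`, then refine until its index in `S_1` is constant. Disjointness forces the faces of that index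
to be `i` and `j`, except over an empty domain. -/
theorem eq_of_obj₁_local (hH : ℋ.IsHypercover) {i j : ℋ.S _⦋0⦌} {V Z : E}
    (x : V ⟶ ℋ.base.comp i) (y : V ⟶ ℋ.base.comp j) (f g : V ⟶ Z)
    (h : ∀ (T : E) (t : T ⟶ V) (ℓ : ℋ.S.Edge i j) (a : T ⟶ obj₁ ℓ),
      a ≫ src ℓ = t ≫ x → a ≫ tgt ℓ = t ≫ y → t ≫ f = t ≫ g) : f = g := by
  have := hH.epi 0
  refine eq_of_edge_local ℋ.H (x ≫ componentι (ℋ.ζn 0) i) (y ≫ componentι (ℋ.ζn 0) j) f g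
    fun T t a ha₁ ha₀ => ?_
  refine eq_of_const_local (a ≫ ℋ.ζn 1) _ _ fun T' t' s hs => ?_
  rw [← Category.assoc] at hs
  have h₁ : const T' (ℋ.S.δ 1 s) = const T' i := by
    rw [← const_δ 1 hs, Category.assoc t', ha₁, ← Category.assoc, ← Category.assoc,
      const_component]
  have h₀ : const T' (ℋ.S.δ 0 s) = const T' j := by
    rw [← const_δ 0 hs, Category.assoc t', ha₀, ← Category.assoc, ← Category.assoc,
      const_component]
  rcases eq_or_forall_eq_of_const_eq h₁ with h₁ | h₁
  swap
  · exact h₁ _ _ _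
  rcases eq_or_forall_eq_of_const_eq h₀ with h₀ | h₀
  swap
  · exact h₀ _ _ _
  rw [← Category.assoc, ← Category.assoc]
  let ℓ : ℋ.S.Edge i j := SSet.Edge.mk s h₁ h₀
  refine h T' (t' ≫ t) ℓ (componentLift (s := ℓ.edge) (t' ≫ a) hs) ?_ ?_
  · apply component_hom_ext
    rw [Category.assoc]
    erw [src_ι]
    rw [← Category.assoc]
    erw [componentLift_ι]
    simp only [Category.assoc, ha₁]
  · apply component_hom_ext
    rw [Category.assoc]
    erw [tgt_ι]
    rw [← Category.assoc]
    erw [componentLift_ι]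
    simp only [Category.assoc, ha₀]

/-- The index of a local filler in `H_2` is the required 2-simplex. The conclusion is an equality of
maps, not the existence of that simplex, because over an empty `V` there may be none. -/
theorem eq_of_compStruct (hH : ℋ.IsHypercover) {i j k : ℋ.S _⦋0⦌} {ℓ : ℋ.S.Edge i j}
    {r : ℋ.S.Edge j k} {q : ℋ.S.Edge i k} {V Z : E} (a : V ⟶ obj₁ ℓ) (b : V ⟶ obj₁ r)
    (c : V ⟶ obj₁ q) (h₀ : a ≫ src ℓ = c ≫ src q) (h₁ : a ≫ tgt ℓ = b ≫ src r)
    (h₂ : b ≫ tgt r = c ≫ tgt q) (f g : V ⟶ Z)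
    (h : Nonempty (SSet.Edge.CompStruct ℓ r q) → f = g) : f = g := by
  have := hH.epi 1
  refine eq_of_triangle_local ℋ.H (a ≫ componentι (ℋ.ζn 1) ℓ.edge)
    (b ≫ componentι (ℋ.ζn 1) r.edge) (c ≫ componentι (ℋ.ζn 1) q.edge) ?_ ?_ ?_ f g
    fun T t w hw₂ hw₀ hw₁ => ?_
  · rw [Category.assoc, Category.assoc, ← src_ι, ← src_ι, reassoc_of% h₀]
  · rw [Category.assoc, Category.assoc, ← src_ι, ← tgt_ι, reassoc_of% h₁]
  · rw [Category.assoc, Category.assoc, ← tgt_ι, ← tgt_ι, reassoc_of% h₂]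
  refine eq_of_const_local (w ≫ ℋ.ζn 2) _ _ fun T' t' s hs => ?_
  rw [← Category.assoc] at hs
  have key : ∀ (m : Fin 3) {i' j' : ℋ.S _⦋0⦌} (e : ℋ.S.Edge i' j') (p : V ⟶ obj₁ e),
      w ≫ ℋ.H.δ m = t ≫ p ≫ componentι (ℋ.ζn 1) e.edge →
      const T' (ℋ.S.δ m s) = const T' e.edge := by
    intro m i' j' e p hp
    rw [← const_δ m hs, Category.assoc t', hp, ← Category.assoc, ← Category.assoc,
      const_component]
  rcases eq_or_forall_eq_of_const_eq (key 2 ℓ a hw₂) with e₂ | e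
  swap
  · exact e _ _ _
  rcases eq_or_forall_eq_of_const_eq (key 0 r b hw₀) with e₀ | e
  swap
  · exact e _ _ _
  rcases eq_or_forall_eq_of_const_eq (key 1 q c hw₁) with e₁ | e
  swap
  · exact e _ _ _
  rw [h ⟨SSet.Edge.CompStruct.mk s e₂ e₀ e₁⟩]

/-- The degeneracy `U_i ⟶ (H_1)_{σ_0 i}`. -/
def degeneracy (i : ℋ.S _⦋0⦌) : ℋ.base.comp i ⟶ obj₁ (SSet.Edge.id i) :=
  componentMap (ζ := ℋ.ζn 0) (ζ' := ℋ.ζn 1) (ℋ.H.σ 0) (ℋ.S.σ 0) (σ_ζn 0) rfl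

theorem degeneracy_src (i : ℋ.S _⦋0⦌) : degeneracy i ≫ src (SSet.Edge.id i) = 𝟙 _ := by
  apply component_hom_ext
  rw [Category.assoc, Category.id_comp]
  erw [src_ι]
  rw [← Category.assoc]
  erw [componentMap_ι]
  have : ℋ.H.σ (0 : Fin 1) ≫ ℋ.H.δ 1 = 𝟙 _ := ℋ.H.δ_comp_σ_succ (i := (0 : Fin 1))
  rw [Category.assoc, this, Category.comp_id]

theorem degeneracy_tgt (i : ℋ.S _⦋0⦌) : degeneracy i ≫ tgt (SSet.Edge.id i) = 𝟙 _ := by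
  apply component_hom_ext
  rw [Category.assoc, Category.id_comp]
  erw [tgt_ι]
  rw [← Category.assoc]
  erw [componentMap_ι]
  have : ℋ.H.σ (0 : Fin 1) ≫ ℋ.H.δ 0 = 𝟙 _ := ℋ.H.δ_comp_σ_self (i := (0 : Fin 1))
  rw [Category.assoc, this, Category.comp_id]

end SimplicialFamily

end

end SpanTopos

/-! ### Invertibility in the fundamental groupoid and its topos of actions -/

namespace SpanTopos

open Simplicial

/-- Functors on `G` are presheaves on `Gᵒᵖ`, that is, sheaves for the trivial topology. -/
theorem isGrothendieckTopos_functor (G : Type u) [SmallCategory G] :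
    IsGrothendieckTopos.{u} (G ⥤ Type u) :=
  ⟨Gᵒᵖ, inferInstance, ⊥,
    ⟨(opOpEquivalence G).symm.congrLeft.trans (sheafBotEquivalence (C := Gᵒᵖ) (Type u)).symm⟩⟩

namespace SimplicialFamily

variable {E : Type w} [Category.{u} E] [IsGrothendieckTopos E] (ℋ : SimplicialFamily E)

/-- The class of a 1-simplex in the fundamental groupoid. -/
def edgeClass {i j : ℋ.S _⦋0⦌} (ℓ : ℋ.S.Edge i j) : ℋ.vertex i ⟶ ℋ.vertex j :=
  (CategoryTheory.Quotient.functor ℋ.basicRel).map (ℋ.basicPath ℓ)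

theorem edgeClass_id (i : ℋ.S _⦋0⦌) : ℋ.edgeClass (SSet.Edge.id i) = 𝟙 _ :=
  (CategoryTheory.Quotient.sound _ (basicRel.ident i)).trans
    ((CategoryTheory.Quotient.functor ℋ.basicRel).map_id _)

theorem edgeClass_comp {i j k : ℋ.S _⦋0⦌} {ℓ : ℋ.S.Edge i j} {r : ℋ.S.Edge j k}
    {t : ℋ.S.Edge i k} (w : SSet.Edge.CompStruct ℓ r t) :
    ℋ.edgeClass t = ℋ.edgeClass ℓ ≫ ℋ.edgeClass r :=
  (CategoryTheory.Quotient.sound _ (basicRel.comp ℓ r t w)).trans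
    ((CategoryTheory.Quotient.functor ℋ.basicRel).map_comp _ _)

theorem edgeClass_eq {i j : ℋ.S _⦋0⦌} {ℓ t : ℋ.S.Edge i j} (h : SpanLE ℓ t) :
    ℋ.edgeClass ℓ = ℋ.edgeClass t :=
  CategoryTheory.Quotient.sound _ (basicRel.span ℓ t h)

variable {ℋ}

/-- The common leg followed by the degeneracy is a morphism of spans. -/
theorem spanLE_id {i : ℋ.S _⦋0⦌} (t : ℋ.S.Edge i i) (h : src t = tgt t) :
    SpanLE t (SSet.Edge.id i) :=
  ⟨src t ≫ degeneracy i, by rw [Category.assoc, degeneracy_src, Category.comp_id],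
    by rw [Category.assoc, degeneracy_tgt, Category.comp_id, h]⟩

theorem isIso_edgeClass {τ : ℋ.SelfDuality} (hG : τ.ConditionG) {i j : ℋ.S _⦋0⦌}
    (ℓ : ℋ.S.Edge i j) : IsIso (ℋ.edgeClass ℓ) := by
  have key : ∀ {i j : ℋ.S _⦋0⦌} (ℓ : ℋ.S.Edge i j),
      ℋ.edgeClass ℓ ≫ ℋ.edgeClass (τ.opEdge ℓ) = 𝟙 _ := by
    intro i j ℓ
    obtain ⟨t, ⟨w⟩, ht⟩ := hG i j ℓ
    rw [← edgeClass_comp ℋ w, edgeClass_eq ℋ (spanLE_id t ht), edgeClass_id]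
  have h₁ := key ℓ
  have h₂ := key (τ.opEdge ℓ)
  -- The duality is not assumed to be involutive; the class of `ℓ^op` has a one-sided inverse on
  -- each side, and these coincide.
  have h₃ : ℋ.edgeClass (τ.opEdge (τ.opEdge ℓ)) = ℋ.edgeClass ℓ := by
    rw [← Category.id_comp (ℋ.edgeClass (τ.opEdge (τ.opEdge ℓ))), ← h₁, Category.assoc, h₂,
      Category.comp_id]
  rw [h₃] at h₂
  exact ⟨_, h₁, h₂⟩

theorem isGroupoid_fundGroupoid {τ : ℋ.SelfDuality} (hG : τ.ConditionG) :
    IsGroupoid ℋ.FundGroupoid := by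
  have key : ∀ {a b : Paths ℋ.Vertex} (p : a ⟶ b),
      IsIso ((CategoryTheory.Quotient.functor ℋ.basicRel).map p) := by
    refine Paths.induction (fun p => IsIso ((CategoryTheory.Quotient.functor ℋ.basicRel).map p))
      inferInstance ?_
    intro a b c p e hp
    have h₁ : IsIso ((CategoryTheory.Quotient.functor ℋ.basicRel).map
      ((Paths.of ℋ.Vertex).map e)) := isIso_edgeClass hG e
    rw [Functor.map_comp]
    infer_instance
  refine ⟨fun {a b} f => ?_⟩
  obtain ⟨p, rfl⟩ := (CategoryTheory.Quotient.functor ℋ.basicRel).map_surjective f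
  exact key p

end SimplicialFamily

end SpanTopos

/-! ### Effective descent along the cover -/

namespace SpanTopos

noncomputable section

attribute [local simp] Limits.prod.lift_fst Limits.prod.lift_snd Limits.prod.lift_fst_assoc
  Limits.prod.lift_snd_assoc

section

variable {E : Type w} [Category.{u} E] [IsGrothendieckTopos E]

theorem eq_of_forall_lift {A B Z : E} {f g : A ⨯ B ⟶ Z}
    (h : ∀ (T : E) (a : T ⟶ A) (b : T ⟶ B), prod.lift a b ≫ f = prod.lift a b ≫ g) : f = g := by
  have h₁ := h _ prod.fst prod.snd
  have h₂ : prod.lift (prod.fst (X := A) (Y := B)) prod.snd = 𝟙 _ := by ext <;> simp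
  rwa [h₂, Category.id_comp, Category.id_comp] at h₁

theorem eq_lift {A B T : E} (f : T ⟶ A ⨯ B) : f = prod.lift (f ≫ prod.fst) (f ≫ prod.snd) := by
  ext <;> simp

theorem eq_of_forall_lift_lift {A B C Z : E} {f g : A ⨯ (B ⨯ C) ⟶ Z}
    (h : ∀ (T : E) (a : T ⟶ A) (b : T ⟶ B) (c : T ⟶ C),
      prod.lift a (prod.lift b c) ≫ f = prod.lift a (prod.lift b c) ≫ g) : f = g :=
  eq_of_forall_lift fun T a b => by rw [eq_lift b, h]

variable {𝒰 : Family E}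

theorem Family.IsCover.eq_of_local (h𝒰 : 𝒰.IsCover) {V Z : E} (f g : V ⟶ Z)
    (h : ∀ (T : E) (t : T ⟶ V) (i : 𝒰.I) (_ : T ⟶ 𝒰.comp i), t ≫ f = t ≫ g) : f = g := by
  have : Epi (terminal.from 𝒰.U) := h𝒰
  refine eq_of_epi_local (terminal.from 𝒰.U) (terminal.from V) f g fun T t a _ => ?_
  refine eq_of_const_local (a ≫ 𝒰.ζ) _ _ fun T' t' i ht => ?_
  rw [← Category.assoc, ← Category.assoc]
  exact h T' (t' ≫ t) i (componentLift (t' ≫ a) (by rw [Category.assoc, ht]))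

namespace LocConst

variable {A B : LocConst 𝒰}

/-- Over an element of some `U_i` the trivializations express `f` through `φ`; as such elements
exist locally, `φ` determines `f`. -/
theorem Hom.lift_comp_f (g : LocConst.Hom A B) {i : 𝒰.I} {T : E} (t : T ⟶ A.X)
    (x : T ⟶ 𝒰.comp i) : t ≫ g.f = prod.lift t x ≫ (A.θ i).inv ≫
      prod.map (gammaMap (g.φ i)) (𝟙 _) ≫ (B.θ i).hom ≫ prod.fst := by
  rw [← reassoc_of% g.comm i]
  simp

theorem Hom.ext_of_isCover (h𝒰 : 𝒰.IsCover) {g g' : LocConst.Hom A B} (h : g.φ = g'.φ) :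
    g = g' := by
  refine LocConst.Hom.ext (h𝒰.eq_of_local _ _ fun T t i x => ?_) h
  rw [g.lift_comp_f t x, g'.lift_comp_f t x, h]

end LocConst

theorem faithful_descentFunctor (h𝒰 : 𝒰.IsCover) : (descentFunctor 𝒰).Faithful :=
  ⟨fun {_ _ _ _} h => LocConst.Hom.ext_of_isCover h𝒰 (congrArg DescentDatum.Hom.φ h)⟩

/-- The projections `X × U_i ⟶ X` are jointly epimorphic, and the maps induced by `φ_i` through the
trivializations agree on overlaps exactly because `φ` commutes with the descent isomorphisms. -/
theorem full_descentFunctor (h𝒰 : 𝒰.IsCover) : (descentFunctor 𝒰).Full := by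
  refine ⟨fun {A B} ψ => ?_⟩
  have he : JointlyEpi fun i : 𝒰.I => (prod.fst : A.X ⨯ 𝒰.comp i ⟶ A.X) := by
    intro Z f g h
    refine h𝒰.eq_of_local f g fun T t i x => ?_
    simpa using prod.lift t x ≫= h i
  let φ : ∀ i, A.R i → B.R i := DescentDatum.Hom.φ ψ
  have hφ : ∀ {i j : 𝒰.I} {T : E} (a : T ⟶ (gammaStar E).obj (A.R i)) (x : T ⟶ 𝒰.comp i)
      (y : T ⟶ 𝒰.comp j),
      (prod.lift (prod.lift a x ≫ (A.θ i).hom ≫ prod.fst) y ≫ (A.θ j).inv ≫ prod.fst) ≫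
        gammaMap (φ j) = prod.lift (prod.lift (a ≫ gammaMap (φ i)) x ≫ (B.θ i).hom ≫ prod.fst) y ≫
          (B.θ j).inv ≫ prod.fst := by
    intro i j T a x y
    have h₁ : (A.σ i j).hom ≫ prod.map (gammaMap (φ j)) (𝟙 _) =
      prod.map (gammaMap (φ i)) (𝟙 _) ≫ (B.σ i j).hom := DescentDatum.Hom.comm ψ i j
    have h₂ := prod.lift a (prod.lift x y) ≫= h₁ =≫ prod.fst
    rw [Category.assoc, reassoc_of% A.lift_σ a x y, Category.assoc, prod.lift_map_assoc,
      prod.lift_map_assoc, Category.comp_id, Category.comp_id,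
      reassoc_of% B.lift_σ (a ≫ gammaMap (φ i)) x y] at h₂
    simpa using h₂
  obtain ⟨f, hf⟩ := he.exists_desc
    (fun i => (A.θ i).inv ≫ prod.map (gammaMap (φ i)) (𝟙 _) ≫ (B.θ i).hom ≫ prod.fst) (by
      intro T i j p q hpq
      obtain ⟨a, x, rfl⟩ : ∃ (a : T ⟶ (gammaStar E).obj (A.R i)) (x : T ⟶ 𝒰.comp i),
          p = prod.lift a x ≫ (A.θ i).hom :=
        ⟨p ≫ (A.θ i).inv ≫ prod.fst, p ≫ (A.θ i).inv ≫ prod.snd, by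
          rw [← Iso.comp_inv_eq]; ext <;> simp⟩
      obtain ⟨y, rfl⟩ : ∃ y, q = prod.lift (prod.lift a x ≫ (A.θ i).hom ≫ prod.fst) y :=
        ⟨q ≫ prod.snd, by
          ext
          · simpa using hpq.symm
          · simp⟩
      rw [reassoc_of% A.lift_θ_inv, prod.lift_map_assoc, hφ, Category.comp_id,
        ← reassoc_of% B.lift_θ_inv]
      simp)
  refine ⟨⟨f, φ, fun i => ?_⟩, rfl⟩
  have h₁ := hf i
  rw [← Iso.eq_inv_comp]
  ext
  · simpa using h₁
  · simp [A.θ_inv_snd, B.θ_snd]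

namespace DescentDatum

variable (D : DescentDatum 𝒰)

theorem lift_σ {i j : 𝒰.I} {T : E} (a : T ⟶ (gammaStar E).obj (D.R i)) (x : T ⟶ 𝒰.comp i)
    (y : T ⟶ 𝒰.comp j) :
    prod.lift a (prod.lift x y) ≫ (D.σ i j).hom =
      prod.lift (prod.lift a (prod.lift x y) ≫ (D.σ i j).hom ≫ prod.fst) (prod.lift y x) := by
  ext <;> simp [D.isOver]

/-- The maps on the pieces of the total object which exhibit it as a quotient. -/
theorem exists_quotient : ∃ (X : E) (q : ∀ i, (gammaStar E).obj (D.R i) ⨯ 𝒰.comp i ⟶ X),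
    (∀ i j, prod.map (𝟙 _) prod.fst ≫ q i = (D.σ i j).hom ≫ prod.map (𝟙 _) prod.fst ≫ q j) ∧
    JointlyEpi q ∧
    ∀ (Z : E) (d : ∀ i, (gammaStar E).obj (D.R i) ⨯ 𝒰.comp i ⟶ Z),
      (∀ i j, prod.map (𝟙 _) prod.fst ≫ d i = (D.σ i j).hom ≫ prod.map (𝟙 _) prod.fst ≫ d j) →
      ∃ m : X ⟶ Z, ∀ i, q i ≫ m = d i := by
  let P : 𝒰.I → E := fun i => (gammaStar E).obj (D.R i) ⨯ 𝒰.comp i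
  let Q : 𝒰.I × 𝒰.I → E := fun p => (gammaStar E).obj (D.R p.1) ⨯ (𝒰.comp p.1 ⨯ 𝒰.comp p.2)
  -- `X` is the coequalizer of the relation that identifies `(a, x)` with `(σ_{j,i}(a, x, y), y)`.
  let l : ∐ Q ⟶ ∐ P := Sigma.desc fun p => prod.map (𝟙 _) prod.fst ≫ Sigma.ι P p.1
  let r : ∐ Q ⟶ ∐ P :=
    Sigma.desc fun p => (D.σ p.1 p.2).hom ≫ prod.map (𝟙 _) prod.fst ≫ Sigma.ι P p.2
  refine ⟨coequalizer l r, fun i => Sigma.ι P i ≫ coequalizer.π l r, fun i j => ?_,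
    fun Z f g h => ?_, fun Z d hd => ⟨coequalizer.desc (Sigma.desc d) ?_, fun i => ?_⟩⟩
  · simpa [l, r] using Sigma.ι Q (i, j) ≫= coequalizer.condition l r
  · refine coequalizer.hom_ext (Sigma.hom_ext _ _ fun i => ?_)
    simpa using h i
  · refine Sigma.hom_ext _ _ fun p => ?_
    simpa [l, r] using hd p.1 p.2
  · simp

/-- The inverse of `θ_k` sends the class of `(a, x)` and an element `z` of `U_k` to `σ_{k,i}(a, x,
z)`. The cocycle condition makes this well defined; the identity condition and the defining relation
of `X` make it a two-sided inverse. -/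
theorem exists_locConst : ∃ A : LocConst 𝒰, A.descentDatum = D := by
  obtain ⟨X, q, hq, hepi, hdesc⟩ := D.exists_quotient
  have hq' : ∀ {i j : 𝒰.I} {T : E} (a : T ⟶ (gammaStar E).obj (D.R i)) (x : T ⟶ 𝒰.comp i)
      (y : T ⟶ 𝒰.comp j), prod.lift (prod.lift a (prod.lift x y) ≫ (D.σ i j).hom ≫ prod.fst) y ≫
        q j = prod.lift a x ≫ q i := by
    intro i j T a x y
    have h := prod.lift a (prod.lift x y) ≫= hq i j
    rw [reassoc_of% D.lift_σ a x y] at h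
    simpa using h.symm
  have hm : ∀ k, ∃ m : X ⨯ 𝒰.comp k ⟶ (gammaStar E).obj (D.R k), ∀ {i : 𝒰.I} {T : E}
      (a : T ⟶ (gammaStar E).obj (D.R i)) (x : T ⟶ 𝒰.comp i) (z : T ⟶ 𝒰.comp k),
      prod.lift (prod.lift a x ≫ q i) z ≫ m =
        prod.lift a (prod.lift x z) ≫ (D.σ i k).hom ≫ prod.fst := by
    intro k
    -- Transposing to the exponential lets the map be defined on the quotient `X` itself instead of
    -- on `X × U_k`.
    obtain ⟨P, ev, hP⟩ := exists_exponential (𝒰.comp k) ((gammaStar E).obj (D.R k))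
    choose d hd hd' using fun i => hP ((gammaStar E).obj (D.R i) ⨯ 𝒰.comp i)
      ((Limits.prod.associator _ _ _).hom ≫ (D.σ i k).hom ≫ prod.fst)
    have hd₁ : ∀ {i : 𝒰.I} {T : E} (a : T ⟶ (gammaStar E).obj (D.R i)) (x : T ⟶ 𝒰.comp i)
        (z : T ⟶ 𝒰.comp k), prod.lift (prod.lift a x ≫ d i) z ≫ ev =
          prod.lift a (prod.lift x z) ≫ (D.σ i k).hom ≫ prod.fst := by
      intro i T a x z
      have h₁ := prod.lift (prod.lift a x) z ≫= hd i
      have h₂ : prod.lift (prod.lift a x) z ≫ (Limits.prod.associator _ _ _).hom =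
          prod.lift a (prod.lift x z) := by
        ext <;> simp
      rw [prod.lift_map_assoc, Category.comp_id, reassoc_of% h₂] at h₁
      exact h₁
    obtain ⟨m, hm⟩ := hdesc P d (by
      intro i j
      obtain ⟨c, -, hc⟩ := hP _
        (prod.map (prod.map (𝟙 ((gammaStar E).obj (D.R i)))
          (prod.fst (X := 𝒰.comp i) (Y := 𝒰.comp j)) ≫ d i) (𝟙 _) ≫ ev)
      rw [hc _ rfl]
      refine (hc _ (eq_of_forall_lift fun T p z => ?_)).symm
      rw [eq_lift p, eq_lift (p ≫ prod.snd)]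
      generalize p ≫ prod.fst = a
      generalize (p ≫ prod.snd) ≫ prod.fst = x
      generalize (p ≫ prod.snd) ≫ prod.snd = y
      rw [prod.lift_map_assoc, prod.lift_map_assoc, reassoc_of% D.lift_σ a x y,
        prod.lift_map_assoc, prod.lift_map_assoc, prod.lift_fst, prod.lift_fst, Category.comp_id,
        Category.comp_id, Category.comp_id, hd₁, hd₁, D.cocycle])
    refine ⟨prod.map m (𝟙 _) ≫ ev, fun {i T} a x z => ?_⟩
    rw [prod.lift_map_assoc, Category.assoc, hm, Category.comp_id, hd₁]
  choose m hm using hm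
  let θ : ∀ k, (gammaStar E).obj (D.R k) ⨯ 𝒰.comp k ≅ X ⨯ 𝒰.comp k := fun k =>
    { hom := prod.lift (q k) prod.snd
      inv := prod.lift (m k) prod.snd
      hom_inv_id := eq_of_forall_lift fun T a x => by
        have h₁ := hm k a x x
        rw [reassoc_of% D.identity k a x, prod.lift_fst] at h₁
        ext
        · simpa [prod.comp_lift_assoc] using h₁
        · simp
      inv_hom_id := by
        refine hepi.eq_of_local prod.fst _ _ fun T t i p hp => ?_
        rw [eq_lift p] at hp
        rw [eq_lift t, ← hp]
        have h₁ := hm k (p ≫ prod.fst) (p ≫ prod.snd) (t ≫ prod.snd)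
        have h₂ := hq' (p ≫ prod.fst) (p ≫ prod.snd) (t ≫ prod.snd)
        rw [← h₁] at h₂
        ext
        · simpa [prod.comp_lift_assoc] using h₂
        · simp }
  have key : ∀ {i j : 𝒰.I} {T : E} (a : T ⟶ (gammaStar E).obj (D.R i)) (x : T ⟶ 𝒰.comp i)
      (y : T ⟶ 𝒰.comp j), prod.lift (prod.lift (prod.lift a x ≫ (θ i).hom ≫ prod.fst) y ≫
        (θ j).inv ≫ prod.fst) (prod.lift y x) = prod.lift a (prod.lift x y) ≫ (D.σ i j).hom := by
    intro i j T a x y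
    rw [D.lift_σ, ← hm j a x y]
    simp [θ]
  let A : LocConst 𝒰 := ⟨X, D.R, θ, fun i => by simp [θ]⟩
  refine ⟨A, ?_⟩
  refine DescentDatum.ext rfl (heq_of_eq ?_)
  funext i j
  ext1
  refine eq_of_forall_lift_lift fun T a x y => ?_
  exact (A.lift_σ a x y).trans (key a x y)

end DescentDatum

end

end

end SpanTopos

/-! ### Trivialized descent data and their morphisms -/

namespace SpanTopos

noncomputable section

open Simplicial

attribute [local simp] Limits.prod.lift_fst Limits.prod.lift_snd Limits.prod.lift_fst_assoc
  Limits.prod.lift_snd_assoc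

namespace SimplicialFamily

variable {E : Type w} [Category.{u} E] [IsGrothendieckTopos E] {ℋ : SimplicialFamily E}

section Duality

variable (τ : ℋ.SelfDuality)

theorem onObj₁_ι {i j : ℋ.S _⦋0⦌} (ℓ : ℋ.S.Edge i j) :
    τ.onObj₁ ℓ ≫ componentι (ℋ.ζn 1) (τ.opEdge ℓ).edge =
      componentι (ℋ.ζn 1) ℓ.edge ≫ (τ.onH.τ 1).hom :=
  componentMap_ι _ _ _ _

theorem onObj₁_src {i j : ℋ.S _⦋0⦌} (ℓ : ℋ.S.Edge i j) :
    τ.onObj₁ ℓ ≫ src (τ.opEdge ℓ) = tgt ℓ := by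
  apply component_hom_ext
  have h : (τ.onH.τ 1).hom ≫ ℋ.H.δ 1 = ℋ.H.δ 0 := by
    have h := τ.onH.δ 0 1
    rw [τ.onH.zero] at h
    exact h.trans (Category.comp_id _)
  rw [Category.assoc]
  erw [src_ι, tgt_ι]
  rw [← Category.assoc, onObj₁_ι, Category.assoc, h]

theorem onObj₁_tgt {i j : ℋ.S _⦋0⦌} (ℓ : ℋ.S.Edge i j) :
    τ.onObj₁ ℓ ≫ tgt (τ.opEdge ℓ) = src ℓ := by
  apply component_hom_ext
  have h : (τ.onH.τ 1).hom ≫ ℋ.H.δ 0 = ℋ.H.δ 1 := by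
    have h := τ.onH.δ 0 0
    rw [τ.onH.zero] at h
    exact h.trans (Category.comp_id _)
  rw [Category.assoc]
  erw [src_ι, tgt_ι]
  rw [← Category.assoc, onObj₁_ι, Category.assoc, h]

variable {τ}

/-- Since `(τ_1)_ℓ` interchanges the legs, only the first component of the correspondence has
content, and the duality drops out. -/
theorem trivializedBy_iff {D : DescentDatum ℋ.base} {s : SDescentDatum ℋ.S D.R} :
    τ.TrivializedBy D s ↔ ∀ {i j : ℋ.S _⦋0⦌} (ℓ : ℋ.S.Edge i j) {T : E}
      (a : T ⟶ (gammaStar E).obj (D.R i)) (v : T ⟶ obj₁ ℓ),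
      prod.lift a (prod.lift (v ≫ src ℓ) (v ≫ tgt ℓ)) ≫ (D.σ i j).hom ≫ prod.fst =
        a ≫ gammaMap (s.s ℓ) := by
  have e₁ : ∀ {i j : ℋ.S _⦋0⦌} (ℓ : ℋ.S.Edge i j) {T : E}
      (a : T ⟶ (gammaStar E).obj (D.R i)) (v : T ⟶ obj₁ ℓ),
      prod.lift a v ≫ prod.map (𝟙 _) (h₁ ℓ) = prod.lift a (prod.lift (v ≫ src ℓ) (v ≫ tgt ℓ)) := by
    intro i j ℓ T a v
    simp [h₁]
  have e₂ : ∀ {i j : ℋ.S _⦋0⦌} (ℓ : ℋ.S.Edge i j) {T : E}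
      (a : T ⟶ (gammaStar E).obj (D.R i)) (v : T ⟶ obj₁ ℓ),
      prod.lift a v ≫ prod.map (gammaMap (s.s ℓ)) (τ.onObj₁ ℓ) ≫ prod.map (𝟙 _) (h₁ (τ.opEdge ℓ)) =
        prod.lift (a ≫ gammaMap (s.s ℓ)) (prod.lift (v ≫ tgt ℓ) (v ≫ src ℓ)) := by
    intro i j ℓ T a v
    simp [h₁, onObj₁_src, onObj₁_tgt]
  constructor
  · intro h i j ℓ T a v
    have h' := prod.lift a v ≫= (h ℓ).2
    rw [e₂, reassoc_of% e₁] at h'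
    simpa using h' =≫ prod.fst
  · intro h i j ℓ
    refine ⟨by simp, eq_of_forall_lift fun T a v => ?_⟩
    rw [e₂, reassoc_of% e₁, D.lift_σ, h]

theorem TrivializedBy.isCoveringProjection (hH : ℋ.IsHypercover) {D : DescentDatum ℋ.base}
    {s : SDescentDatum ℋ.S D.R} (h : τ.TrivializedBy D s) : D.IsCoveringProjection := by
  intro i j _ Z f g hfg
  refine eq_of_obj₁_local hH (i := i) (j := j) prod.fst prod.snd f g fun T t ℓ a ha₁ ha₂ => ?_
  have ht : t = a ≫ prod.lift (src ℓ) (tgt ℓ) := by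
    ext
    · simpa using ha₁.symm
    · simpa using ha₂.symm
  rw [ht, Category.assoc, Category.assoc, hfg _ (src ℓ) (tgt ℓ) ⟨ℋ.nonempty 1 ℓ.edge, s.s ℓ, ?_⟩]
  refine eq_of_forall_lift fun T a v => ?_
  have h' := trivializedBy_iff.1 h ℓ a v
  rw [prod.lift_map_assoc, prod.lift_map_assoc, prod.lift_map, prod.comp_lift, prod.comp_lift,
    Category.comp_id, Category.comp_id, Category.comp_id, D.lift_σ, h']

/-- Both sides are compared as constant elements over `(H_1)_ℓ`; its non-emptiness turns equality of
constants into equality in the set. -/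
theorem TrivializedBy.map_comm {D D' : DescentDatum ℋ.base} {s : SDescentDatum ℋ.S D.R}
    {s' : SDescentDatum ℋ.S D'.R} (h : τ.TrivializedBy D s) (h' : τ.TrivializedBy D' s')
    (g : DescentDatum.Hom D D') {i j : ℋ.S _⦋0⦌} (ℓ : ℋ.S.Edge i j) (r : D.R i) :
    g.φ j (s.s ℓ r) = s'.s ℓ (g.φ i r) := by
  apply eq_of_const_eq (E := E) (ℋ.nonempty 1 ℓ.edge)
  have e := trivializedBy_iff.1 h ℓ (const _ r) (𝟙 (obj₁ ℓ))
  have e' := trivializedBy_iff.1 h' ℓ (const _ (g.φ i r)) (𝟙 (obj₁ ℓ))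
  rw [const_gammaMap] at e e'
  refine Eq.trans ?_ e'
  rw [← const_gammaMap (g.φ j)]
  refine Eq.trans (congrArg (· ≫ gammaMap (g.φ j)) e.symm) ?_
  have c := prod.lift (const (obj₁ ℓ) r) (prod.lift (𝟙 _ ≫ src ℓ) (𝟙 _ ≫ tgt ℓ)) ≫= g.comm i j =≫
    prod.fst
  rw [Category.assoc, Category.assoc, prod.map_fst, prod.lift_map_assoc,
    const_gammaMap, Category.comp_id] at c
  simpa only [Category.assoc] using c

theorem TrivializedBy.unique {D : DescentDatum ℋ.base} {s s' : SDescentDatum ℋ.S D.R}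
    (h : τ.TrivializedBy D s) (h' : τ.TrivializedBy D s') : s = s' := by
  have : ∀ {i j : ℋ.S _⦋0⦌} (ℓ : ℋ.S.Edge i j), s.s ℓ = s'.s ℓ := fun ℓ =>
    Equiv.ext fun r => TrivializedBy.map_comm h h' (𝟙 D : D ⟶ D) ℓ r
  cases s
  cases s'
  congr
  funext i j ℓ
  exact this ℓ

theorem hom_comm_of_trivializedBy (hH : ℋ.IsHypercover) {D D' : DescentDatum ℋ.base}
    {s : SDescentDatum ℋ.S D.R}
    {s' : SDescentDatum ℋ.S D'.R} (h : τ.TrivializedBy D s) (h' : τ.TrivializedBy D' s')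
    (φ : ∀ i, D.R i → D'.R i)
    (hφ : ∀ {i j : ℋ.S _⦋0⦌} (ℓ : ℋ.S.Edge i j) (r : D.R i), φ j (s.s ℓ r) = s'.s ℓ (φ i r))
    (i j : ℋ.S _⦋0⦌) : (D.σ i j).hom ≫ prod.map (gammaMap (φ j)) (𝟙 _) =
      prod.map (gammaMap (φ i)) (𝟙 _) ≫ (D'.σ i j).hom := by
  refine eq_of_forall_lift_lift fun T a x y => ?_
  refine eq_of_obj₁_local hH x y _ _ fun T' t ℓ v hx hy => ?_
  have e : t ≫ prod.lift a (prod.lift x y) =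
      prod.lift (t ≫ a) (prod.lift (v ≫ src ℓ) (v ≫ tgt ℓ)) := by
    simp [hx, hy]
  rw [reassoc_of% e, reassoc_of% e, prod.lift_map_assoc, Category.comp_id,
    reassoc_of% D.lift_σ (t ≫ a) (v ≫ src ℓ) (v ≫ tgt ℓ), D'.lift_σ, trivializedBy_iff.1 h,
    trivializedBy_iff.1 h', prod.lift_map, Category.comp_id]
  simp only [Category.assoc]
  rw [← gammaMap_comp, ← gammaMap_comp]
  congr 4
  funext r
  exact hφ ℓ r

end Duality

/-! ### Gluing an `S`-descent datum to a Čech descent datum -/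

section DescentOfAction

variable {R : ℋ.S _⦋0⦌ → Type u} (s : SDescentDatum ℋ.S R)

theorem exists_σ (hH : ℋ.IsHypercover) (i j : ℋ.S _⦋0⦌) :
    ∃ m : (gammaStar E).obj (R i) ⨯ (ℋ.base.comp i ⨯ ℋ.base.comp j) ⟶ (gammaStar E).obj (R j),
      ∀ (ℓ : ℋ.S.Edge i j) {T : E} (a : T ⟶ (gammaStar E).obj (R i)) (x : T ⟶ ℋ.base.comp i)
        (y : T ⟶ ℋ.base.comp j) (v : T ⟶ obj₁ ℓ), v ≫ src ℓ = x → v ≫ tgt ℓ = y →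
        prod.lift a (prod.lift x y) ≫ m = a ≫ gammaMap (s.s ℓ) := by
  have he : JointlyEpi fun ℓ : ℋ.S.Edge i j => h₁ ℓ := by
    intro Z f g h
    refine eq_of_obj₁_local hH (i := i) (j := j) prod.fst prod.snd f g fun T t ℓ a ha₁ ha₂ => ?_
    have ht : t = a ≫ h₁ ℓ := by
      ext
      · simpa [h₁] using ha₁.symm
      · simpa [h₁] using ha₂.symm
    rw [ht, Category.assoc, Category.assoc, h]
  obtain ⟨m, hm⟩ := (he.prod_map_left ((gammaStar E).obj (R i))).exists_desc
    (fun ℓ => prod.fst ≫ gammaMap (s.s ℓ)) (by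
      intro T ℓ ℓ' p q hpq
      have e₀ : p ≫ prod.fst = q ≫ prod.fst := by simpa using hpq =≫ prod.fst
      have e₁ : p ≫ prod.snd ≫ src ℓ = q ≫ prod.snd ≫ src ℓ' := by
        simpa [h₁] using (hpq =≫ prod.snd) =≫ prod.fst
      have e₂ : p ≫ prod.snd ≫ tgt ℓ = q ≫ prod.snd ≫ tgt ℓ' := by
        simpa [h₁] using (hpq =≫ prod.snd) =≫ prod.snd
      -- On an overlap the degenerate edge at `i`, `ℓ'` and `ℓ` bound a triangle, so its filler
      -- gives `s_ℓ = s_ℓ' ∘ id`.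
      refine eq_of_compStruct hH ((p ≫ prod.snd ≫ src ℓ) ≫ degeneracy i) (q ≫ prod.snd)
        (p ≫ prod.snd) ?_ ?_ ?_ _ _ ?_
      · rw [Category.assoc, degeneracy_src, Category.comp_id, Category.assoc]
      · rw [Category.assoc, degeneracy_tgt, Category.comp_id, Category.assoc, e₁]
      · rw [Category.assoc, Category.assoc, e₂]
      · rintro ⟨c⟩
        rw [← Category.assoc, ← Category.assoc, e₀, s.comp c, s.id, Equiv.refl_trans])
  refine ⟨m, fun ℓ T a x y v hx hy => ?_⟩
  have e : prod.lift a (prod.lift x y) = prod.lift a v ≫ prod.map (𝟙 _) (h₁ ℓ) := by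
    simp [h₁, hx, hy]
  rw [e, Category.assoc, hm]
  simp

/-- The first component of the descent isomorphisms given by an `S`-descent datum. -/
def σFst (hH : ℋ.IsHypercover) (i j : ℋ.S _⦋0⦌) :
    (gammaStar E).obj (R i) ⨯ (ℋ.base.comp i ⨯ ℋ.base.comp j) ⟶ (gammaStar E).obj (R j) :=
  (exists_σ s hH i j).choose

theorem lift_σFst (hH : ℋ.IsHypercover) {i j : ℋ.S _⦋0⦌} (ℓ : ℋ.S.Edge i j) {T : E}
    (a : T ⟶ (gammaStar E).obj (R i)) {x : T ⟶ ℋ.base.comp i}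
    {y : T ⟶ ℋ.base.comp j} (v : T ⟶ obj₁ ℓ) (hx : v ≫ src ℓ = x) (hy : v ≫ tgt ℓ = y) :
    prod.lift a (prod.lift x y) ≫ σFst s hH i j = a ≫ gammaMap (s.s ℓ) :=
  (exists_σ s hH i j).choose_spec ℓ a x y v hx hy

theorem σFst_identity (hH : ℋ.IsHypercover) {i : ℋ.S _⦋0⦌} {T : E}
    (a : T ⟶ (gammaStar E).obj (R i)) (x : T ⟶ ℋ.base.comp i) :
    prod.lift a (prod.lift x x) ≫ σFst s hH i i = a := by
  rw [lift_σFst s hH (SSet.Edge.id i) a (x ≫ degeneracy i)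
    (by rw [Category.assoc, degeneracy_src, Category.comp_id])
    (by rw [Category.assoc, degeneracy_tgt, Category.comp_id]), s.id]
  exact ((congrArg (a ≫ ·) (gammaMap_id (R i))).trans (Category.comp_id a))

/-- Three refinements lift `(x, y)`, `(y, z)` and `(x, z)` to elements of `H_1`; these bound a
triangle, whose filler gives the composition law for `s`. -/
theorem σFst_cocycle (hH : ℋ.IsHypercover) {i j k : ℋ.S _⦋0⦌} {T : E}
    (a : T ⟶ (gammaStar E).obj (R i)) (x : T ⟶ ℋ.base.comp i) (y : T ⟶ ℋ.base.comp j)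
    (z : T ⟶ ℋ.base.comp k) :
    prod.lift (prod.lift a (prod.lift x y) ≫ σFst s hH i j) (prod.lift y z) ≫ σFst s hH j k =
      prod.lift a (prod.lift x z) ≫ σFst s hH i k := by
  refine eq_of_obj₁_local hH x y _ _ fun T t ℓ b hb₀ hb₁ => ?_
  simp only [prod.comp_lift_assoc, prod.comp_lift]
  rw [lift_σFst s hH ℓ (t ≫ a) b hb₀ hb₁]
  refine eq_of_obj₁_local hH (t ≫ y) (t ≫ z) _ _ fun T' t' r c hc₀ hc₁ => ?_
  simp only [prod.comp_lift_assoc, prod.comp_lift]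
  rw [lift_σFst s hH r _ c hc₀ hc₁]
  refine eq_of_obj₁_local hH (t' ≫ t ≫ x) (t' ≫ t ≫ z) _ _ fun T'' t'' q d hd₀ hd₁ => ?_
  simp only [prod.comp_lift_assoc, prod.comp_lift]
  rw [lift_σFst s hH q _ d hd₀ hd₁]
  refine eq_of_compStruct hH (t'' ≫ t' ≫ b) (t'' ≫ c) d ?_ ?_ ?_ _ _ ?_
  · rw [Category.assoc, Category.assoc, hb₀, hd₀]
  · rw [Category.assoc, Category.assoc, Category.assoc, hb₁, hc₀]
  · rw [Category.assoc, hc₁, hd₁]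
  · rintro ⟨w⟩
    rw [s.comp w]
    simp only [Category.assoc]
    exact congrArg (fun m => t'' ≫ t' ≫ t ≫ a ≫ m) (gammaMap_comp _ _).symm

/-- The descent datum given by an `S`-descent datum. -/
def descentOf (hH : ℋ.IsHypercover) : DescentDatum ℋ.base where
  R := R
  σ i j :=
    { hom := prod.lift (σFst s hH i j) (prod.snd ≫ (Limits.prod.braiding _ _).hom)
      inv := prod.lift (σFst s hH j i) (prod.snd ≫ (Limits.prod.braiding _ _).hom)
      hom_inv_id := eq_of_forall_lift_lift fun T a x y => by
        -- The cocycle at `(x, y, x)` shows that the isomorphisms in the two directions are mutually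
        -- inverse.
        have h := (σFst_cocycle s hH a x y x).trans (σFst_identity s hH a x)
        ext
        · simpa [prod.comp_lift_assoc] using h
        · simp
        · simp
      inv_hom_id := eq_of_forall_lift_lift fun T a x y => by
        have h := (σFst_cocycle s hH a x y x).trans (σFst_identity s hH a x)
        ext
        · simpa [prod.comp_lift_assoc] using h
        · simp
        · simp }
  isOver i j := by simp
  identity i T a x := by
    ext
    · simpa using σFst_identity s hH a x
    · simp
    · simp
  cocycle i j k T a x y z := by
    simpa using σFst_cocycle s hH a x y z

theorem trivializedBy_descentOf (hH : ℋ.IsHypercover) (τ : ℋ.SelfDuality) :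
    τ.TrivializedBy (descentOf s hH) s :=
  trivializedBy_iff.2 fun ℓ T a v => by
    simpa [descentOf] using lift_σFst s hH ℓ a v rfl rfl

end DescentOfAction

end SimplicialFamily

end

end SpanTopos

/-! ### The isomorphism with actions of the fundamental groupoid -/

namespace SpanTopos

noncomputable section

open Simplicial

namespace SimplicialFamily

variable {E : Type w} [Category.{u} E] [IsGrothendieckTopos E] {ℋ : SimplicialFamily E}

section Action

variable {τ : ℋ.SelfDuality}

/-- The `S`-descent datum given by an action of the fundamental groupoid. -/
def ofAction (hG : τ.ConditionG) (P : ℋ.FundGroupoid ⥤ Type u) :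
    SDescentDatum ℋ.S fun i => P.obj (ℋ.vertex i) where
  s ℓ :=
    have := isIso_edgeClass hG ℓ
    (asIso (P.map (ℋ.edgeClass ℓ))).toEquiv
  id i := Equiv.ext fun r => by
    change P.map (ℋ.edgeClass (SSet.Edge.id i)) r = r
    rw [edgeClass_id, P.map_id]
    rfl
  comp {i j k ℓ r t} c := Equiv.ext fun x => by
    change P.map (ℋ.edgeClass t) x = P.map (ℋ.edgeClass r) (P.map (ℋ.edgeClass ℓ) x)
    rw [edgeClass_comp ℋ c, P.map_comp]
    rfl

theorem ofAction_apply (hG : τ.ConditionG) (P : ℋ.FundGroupoid ⥤ Type u) {i j : ℋ.S _⦋0⦌}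
    (ℓ : ℋ.S.Edge i j) (x : P.obj (ℋ.vertex i)) :
    (ofAction hG P).s ℓ x = P.map (ℋ.edgeClass ℓ) x := rfl

theorem consistent_ofAction (hG : τ.ConditionG) (P : ℋ.FundGroupoid ⥤ Type u) :
    Consistent (ofAction hG P) := fun ℓ t h => Equiv.ext fun x => by
  rw [ofAction_apply, ofAction_apply, edgeClass_eq ℋ h]

theorem action_map_edgeClass {R : ℋ.S _⦋0⦌ → Type u} (s : SDescentDatum ℋ.S R)
    (hs : Consistent s) {i j : ℋ.S _⦋0⦌} (ℓ : ℋ.S.Edge i j) :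
    (action s hs).map (ℋ.edgeClass ℓ) =
      (show (action s hs).obj (ℋ.vertex i) ⟶ (action s hs).obj (ℋ.vertex j) from
        TypeCat.ofHom (s.s ℓ)) :=
  pathAction_basicPath s ℓ

theorem action_ofAction (hG : τ.ConditionG) (P : ℋ.FundGroupoid ⥤ Type u) :
    action (ofAction hG P) (consistent_ofAction hG P) = P := by
  refine CategoryTheory.Quotient.lift_unique' _ _ _
    (Paths.ext_functor (V := ℋ.Vertex) rfl fun a b e => ?_)
  refine (pathAction_basicPath _ _).trans ?_
  exact ((Category.id_comp _).trans (Category.comp_id _)).symm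

theorem ofAction_action (hG : τ.ConditionG) {R : ℋ.S _⦋0⦌ → Type u} (s : SDescentDatum ℋ.S R)
    (hs : Consistent s) : ofAction hG (action s hs) = s := by
  have h : ∀ {i j : ℋ.S _⦋0⦌} (ℓ : ℋ.S.Edge i j), (ofAction hG (action s hs)).s ℓ = s.s ℓ :=
    fun ℓ => Equiv.ext fun x => by
      rw [ofAction_apply, action_map_edgeClass]
      rfl
  generalize ofAction hG (action s hs) = s' at h
  cases s
  cases s'
  congr
  funext i j ℓ
  exact h ℓ

theorem action_congr {R : ℋ.S _⦋0⦌ → Type u} {s s' : SDescentDatum ℋ.S R} (h : s = s')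
    (hs : Consistent s) (hs' : Consistent s') : action s hs = action s' hs' := by
  subst h
  rfl

theorem pathAction_map_comm {R R' : ℋ.S _⦋0⦌ → Type u} {s : SDescentDatum ℋ.S R}
    {s' : SDescentDatum ℋ.S R'} (φ : ∀ i, R i → R' i)
    (hφ : ∀ {i j : ℋ.S _⦋0⦌} (ℓ : ℋ.S.Edge i j) (r : R i), φ j (s.s ℓ r) = s'.s ℓ (φ i r))
    {a b : ℋ.Vertex} (p : Quiver.Path a b) (r : R a) :
    φ b ((pathAction s).map (X := ℋ.pathVertex a) (Y := ℋ.pathVertex b) p r) =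
      (pathAction s').map (X := ℋ.pathVertex a) (Y := ℋ.pathVertex b) p (φ a r) := by
  induction p with
  | nil => rfl
  | cons p e ih => exact (hφ e _).trans (congrArg (s'.s (i := _) (j := _) e) ih)

/-- The map of actions given by a family of functions which commutes with the `S`-descent data. -/
def actionMap {R R' : ℋ.S _⦋0⦌ → Type u} {s : SDescentDatum ℋ.S R} {s' : SDescentDatum ℋ.S R'}
    (hs : Consistent s) (hs' : Consistent s') (φ : ∀ i, R i → R' i)
    (hφ : ∀ {i j : ℋ.S _⦋0⦌} (ℓ : ℋ.S.Edge i j) (r : R i), φ j (s.s ℓ r) = s'.s ℓ (φ i r)) :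
    action s hs ⟶ action s' hs' :=
  CategoryTheory.Quotient.natTransLift ℋ.basicRel
    { app := fun i : ℋ.Vertex =>
        (show (action s hs).obj (ℋ.vertex i) ⟶ (action s' hs').obj (ℋ.vertex i) from
          TypeCat.ofHom (φ i))
      naturality := fun _ _ p =>
        ConcreteCategory.hom_ext _ _ fun r => pathAction_map_comm φ hφ p r }

end Action

/-- The round trips are equal to the identity on objects only propositionally, so morphisms are
compared heterogeneously, through their families of functions. -/
theorem natTrans_heq {P P' Q Q' : ℋ.FundGroupoid ⥤ Type u} (hP : P = P') (hQ : Q = Q')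
    {α : P ⟶ Q} {β : P' ⟶ Q'} (h : ∀ i, HEq (α.app (ℋ.vertex i)) (β.app (ℋ.vertex i))) :
    HEq α β := by
  subst hP hQ
  refine heq_of_eq (NatTrans.ext (funext fun i => ?_))
  exact eq_of_heq (h i.as)

variable (τ : ℋ.SelfDuality)

theorem covProjData_hom_heq {A A' B B' : τ.CovProjData} (hA : A = A') (hB : B = B')
    {f : A ⟶ B} {g : A' ⟶ B'}
    (h : HEq (DescentDatum.Hom.φ f.hom) (DescentDatum.Hom.φ g.hom)) : HEq f g := by
  subst hA hB
  exact heq_of_eq (ObjectProperty.hom_ext _ (DescentDatum.Hom.ext (eq_of_heq h)))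

variable {τ}

/-- The two data have the same trivialization, hence agree on the pieces `(H_1)_ℓ`, which cover `U_i
× U_j`. -/
theorem descentOf_eq (hH : ℋ.IsHypercover) {D : DescentDatum ℋ.base}
    {s : SDescentDatum ℋ.S D.R} (h : τ.TrivializedBy D s) : descentOf s hH = D := by
  refine DescentDatum.ext rfl (heq_of_eq ?_)
  funext i j
  ext1
  refine eq_of_forall_lift_lift fun T a x y => ?_
  refine eq_of_obj₁_local hH x y _ _ fun T' t ℓ v hx hy => ?_
  have e : t ≫ prod.lift a (prod.lift x y) =
      prod.lift (t ≫ a) (prod.lift (v ≫ src ℓ) (v ≫ tgt ℓ)) := by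
    rw [prod.comp_lift, prod.comp_lift, hx, hy]
  rw [reassoc_of% e, reassoc_of% e]
  have e₁ := trivializedBy_iff.1 (trivializedBy_descentOf s hH τ) ℓ (t ≫ a) v
  have e₂ := trivializedBy_iff.1 h ℓ (t ≫ a) v
  exact ((descentOf s hH).lift_σ _ _ _).trans
    ((congrArg (prod.lift · _) (e₁.trans e₂.symm)).trans (D.lift_σ _ _ _).symm)

/-- The `S`-descent datum which trivializes a covering projection. -/
def trivialization (D : τ.CovProjData) : SDescentDatum ℋ.S D.obj.R := D.property.2.choose

theorem consistent_trivialization (D : τ.CovProjData) : Consistent (trivialization D) :=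
  D.property.2.choose_spec.1

theorem trivializedBy_trivialization (D : τ.CovProjData) :
    τ.TrivializedBy D.obj (trivialization D) :=
  D.property.2.choose_spec.2

variable (τ) in
/-- The functor sending a covering projection to its action of the fundamental groupoid. -/
def toAction : τ.CovProjData ⥤ (ℋ.FundGroupoid ⥤ Type u) where
  obj D := action (trivialization D) (consistent_trivialization D)
  map {D D'} g := actionMap _ _ (DescentDatum.Hom.φ g.hom)
    (TrivializedBy.map_comm (trivializedBy_trivialization D) (trivializedBy_trivialization D')
      g.hom)
  map_id D := by
    ext i
    rfl
  map_comp f g := by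
    ext i
    rfl

/-- The functor sending an action of the fundamental groupoid to a covering projection. -/
def toCovProjData (hH : ℋ.IsHypercover) (hG : τ.ConditionG) :
    (ℋ.FundGroupoid ⥤ Type u) ⥤ τ.CovProjData where
  obj P :=
    { obj := descentOf (ofAction hG P) hH
      property := ⟨TrivializedBy.isCoveringProjection hH (trivializedBy_descentOf _ hH τ),
        ofAction hG P, consistent_ofAction hG P, trivializedBy_descentOf _ hH τ⟩ }
  map α := ObjectProperty.homMk
    { φ := fun i => α.app (ℋ.vertex i)
      comm := hom_comm_of_trivializedBy hH (trivializedBy_descentOf _ hH τ)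
        (trivializedBy_descentOf _ hH τ) _ fun ℓ r =>
          NatTrans.naturality_apply α (ℋ.edgeClass ℓ) r }
  map_id _ := rfl
  map_comp _ _ := rfl

theorem toAction_toCovProjData (hH : ℋ.IsHypercover) (hG : τ.ConditionG) :
    toAction τ ⋙ toCovProjData hH hG = 𝟭 _ := by
  have h : ∀ D, (toAction τ ⋙ toCovProjData hH hG).obj D = D := fun D =>
    ObjectProperty.FullSubcategory.ext (by
      have e := ofAction_action hG (trivialization D) (consistent_trivialization D)
      exact (congrArg (fun s : SDescentDatum ℋ.S D.obj.R => descentOf s hH) e).trans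
        (descentOf_eq hH (trivializedBy_trivialization D)))
  exact CategoryTheory.Functor.hext h fun D D' g => covProjData_hom_heq τ (h D) (h D') HEq.rfl

theorem toCovProjData_toAction (hH : ℋ.IsHypercover) (hG : τ.ConditionG) :
    toCovProjData hH hG ⋙ toAction τ = 𝟭 _ := by
  have h : ∀ P, (toCovProjData hH hG ⋙ toAction τ).obj P = P := fun P => by
    -- The trivialization is obtained by choice; uniqueness identifies it with the one coming from
    -- the action.
    have e : trivialization ((toCovProjData hH hG).obj P) = ofAction hG P :=
      TrivializedBy.unique (trivializedBy_trivialization _) (trivializedBy_descentOf _ hH τ)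
    exact (action_congr e (consistent_trivialization _) (consistent_ofAction hG P)).trans (action_ofAction hG P)
  exact CategoryTheory.Functor.hext h fun P P' α => natTrans_heq (h P) (h P') fun i => HEq.rfl

theorem isEquivalence_covProjDescent (hH : ℋ.IsHypercover) :
    τ.covProjDescent.IsEquivalence := by
  have := faithful_descentFunctor hH.cover
  have := full_descentFunctor hH.cover
  let ι := (τ.covProj.inverseImage (descentFunctor ℋ.base)).ι
  have : (ι ⋙ descentFunctor ℋ.base).Faithful := Functor.Faithful.comp _ _
  have : (ι ⋙ descentFunctor ℋ.base).Full := Functor.Full.comp _ _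
  have h₁ : τ.covProjDescent.Faithful :=
    Functor.Faithful.of_comp_iso (τ.covProj.liftCompιIso (ι ⋙ descentFunctor ℋ.base) _)
  have h₂ : τ.covProjDescent.Full :=
    Functor.Full.of_comp_faithful_iso (τ.covProj.liftCompιIso (ι ⋙ descentFunctor ℋ.base) _)
  have h₃ : τ.covProjDescent.EssSurj := by
    refine ⟨fun D => ?_⟩
    obtain ⟨A, hA⟩ := D.obj.exists_locConst
    have hA' : τ.covProj ((descentFunctor ℋ.base).obj A) := by
      change τ.covProj A.descentDatum
      rw [hA]
      exact D.property
    exact ⟨⟨A, hA'⟩, ⟨eqToIso (ObjectProperty.FullSubcategory.ext hA)⟩⟩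
  exact {}

end SimplicialFamily

end

end SpanTopos

theorem mainTheorem2 {E : Type w} [Category.{u} E] [IsGrothendieckTopos.{u} E]
    (ℋ : SpanTopos.SimplicialFamily.{u} E) (τ : ℋ.SelfDuality)
    (hH : ℋ.IsHypercover) (hG : τ.ConditionG) :
    IsGroupoid ℋ.FundGroupoid ∧
    IsGrothendieckTopos.{u} (ℋ.FundGroupoid ⥤ Type u) ∧
    τ.covProjDescent.IsEquivalence ∧
    ∃ (F : τ.CovProjData ⥤ (ℋ.FundGroupoid ⥤ Type u))
      (G : (ℋ.FundGroupoid ⥤ Type u) ⥤ τ.CovProjData),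
      F ⋙ G = 𝟭 _ ∧ G ⋙ F = 𝟭 _ ∧
      (∀ D : τ.CovProjData, ∃ (s : SpanTopos.SDescentDatum ℋ.S D.obj.R)
        (hs : SpanTopos.SimplicialFamily.Consistent s),
        τ.TrivializedBy D.obj s ∧ F.obj D = SpanTopos.SimplicialFamily.action s hs) ∧
      (∀ i : ℋ.base.I, F ⋙ (evaluation _ _).obj (ℋ.vertex i) =
        τ.covProj.ι ⋙ SpanTopos.fibre ℋ.base i) :=
  ⟨SpanTopos.SimplicialFamily.isGroupoid_fundGroupoid hG,
    SpanTopos.isGrothendieckTopos_functor _,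
    SpanTopos.SimplicialFamily.isEquivalence_covProjDescent hH,
    SpanTopos.SimplicialFamily.toAction τ, SpanTopos.SimplicialFamily.toCovProjData hH hG,
    SpanTopos.SimplicialFamily.toAction_toCovProjData hH hG,
    SpanTopos.SimplicialFamily.toCovProjData_toAction hH hG,
    fun D => ⟨SpanTopos.SimplicialFamily.trivialization D,
      SpanTopos.SimplicialFamily.consistent_trivialization D,
      SpanTopos.SimplicialFamily.trivializedBy_trivialization D, rfl⟩,
    fun _ => rfl⟩
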